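/- Let $R$ be a commutative ring with a derivation $D\colon R\to R$ (an additive map satisfying the Leibniz rule), and let $R^D=\{r\in R : D(r)=0\}$ be its subring of constants. A differential Azumaya $R$-algebra is an Azumaya $R$-algebra $A$ together with a derivation $D_A$ of $A$ extending $D$; an isomorphism of differential $R$-algebras is an $R$-algebra isomorphism commuting with the derivations; and $A\otimes_R B$ carries the derivation $D_A\otimes 1+1\otimes D_B$. For a commutative monoid $M$ and a submonoid $N\subseteq M$, let $M/N$ be the quotient monoid of $M$ by the congruence $m_1\sim m_2 \iff m_1n_1=m_2n_2$ for some $n_1,n_2\in N$. For a commutative ring $S$, let $BM(S)=MA(S)/MM(S)$, where $MA(S)$ is the monoid, under tensor product, of isomorphism classes of Azumaya $S$-algebras and $MM(S)$ is the submonoid of classes of the matrix algebras $M_n(S)$, $n\ge 1$. Let $BM^{\mathrm{diff}}(R)=MA^{\mathrm{diff}}(R)/MM_0^{\mathrm{diff}}(R)$, where $MA^{\mathrm{diff}}(R)$ is the monoid, under tensor product, of isomorphism classes of differential Azumaya $R$-algebras and $MM_0^{\mathrm{diff}}(R)$ is the submonoid of classes of the matrix algebras $M_n(R)$, $n\ge1$,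 with entrywise derivation. Theorem. The monoid $BM(R^D)$ is a group, and sending the class of an Azumaya $R^D$-algebra $A_0$ to the class of $R\otimes_{R^D}A_0$ with the derivation $D\otimes 1$ gives a well-defined group isomorphism from $BM(R^D)$ onto the group of units of the monoid $BM^{\mathrm{diff}}(R)$. -/

import Mathlib

universe u

open scoped TensorProduct

namespace DiffBrauer

/-! ### Tensor products and base changes of Azumaya algebras are Azumaya -/

section Azumaya

open MulOpposite

theorem azumaya_exists_data (R A : Type*) [CommRing R] [Ring A] [Algebra R A] [IsAzumaya R A] :
    ∃ (n : ℕ) (x : Fin n → A) (f : Fin n → A →ₗ[R] R) (e : Fin n → A ⊗[R] Aᵐᵒᵖ),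
      (∀ y, ∑ i, f i y • x i = y) ∧
      (∀ i y, AlgHom.mulLeftRight R A (e i) y = algebraMap R A (f i y)) ∧
      (∀ y, ∑ i, ((x i * y) ⊗ₜ[R] (1 : Aᵐᵒᵖ)) * e i = 1 ⊗ₜ op y) := by
  obtain ⟨n, p, hp⟩ := Module.Finite.exists_fin' R A
  obtain ⟨s, hs⟩ := p.exists_rightInverse_of_surjective (LinearMap.range_eq_top.2 hp)
  have hdual : ∀ y, ∑ i, (s y) i • p (Pi.single i 1) = y := fun y => by
    have h : p (s y) = y := DFunLike.congr_fun hs y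
    conv_rhs => rw [← h, ← Finset.univ_sum_single (s y)]
    rw [map_sum]
    refine Finset.sum_congr rfl fun i _ => ?_
    rw [← map_smul, ← Pi.single_smul, smul_eq_mul, mul_one]
  let f : Fin n → A →ₗ[R] R := fun i => (LinearMap.proj i).comp s
  have hb := IsAzumaya.bij (R := R) (A := A)
  choose e he using fun i => hb.2 ((Algebra.linearMap R A).comp (f i))
  have he' : ∀ i y, AlgHom.mulLeftRight R A (e i) y = algebraMap R A (f i y) := fun i y => by
    rw [he]; rfl
  refine ⟨n, fun i => p (Pi.single i 1), f, e, hdual, he', fun y => hb.1 ?_⟩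
  ext z
  simp only [map_sum, map_mul, LinearMap.sum_apply, Module.End.mul_apply, he',
    AlgHom.mulLeftRight_apply, unop_one, mul_one, unop_op, one_mul]
  conv_rhs => rw [← hdual z, Finset.sum_mul]
  refine Finset.sum_congr rfl fun i _ => ?_
  rw [← Algebra.commutes, Algebra.smul_def, mul_assoc]
  rfl

theorem azumaya_bij_of_data (R A : Type*) [CommRing R] [Ring A] [Algebra R A]
    {ι : Type*} [Fintype ι] (x : ι → A) (f : ι → A →ₗ[R] R) (e : ι → A ⊗[R] Aᵐᵒᵖ)
    (h₁ : ∀ y, ∑ i, f i y • x i = y)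
    (h₂ : ∀ i y, AlgHom.mulLeftRight R A (e i) y = algebraMap R A (f i y))
    (h₃ : ∀ y, ∑ i, ((x i * y) ⊗ₜ[R] (1 : Aᵐᵒᵖ)) * e i = 1 ⊗ₜ op y) :
    Function.Bijective (AlgHom.mulLeftRight R A) := by
  constructor
  · refine Function.LeftInverse.injective
      (g := fun g => ∑ i, (g (x i) ⊗ₜ[R] (1 : Aᵐᵒᵖ)) * e i) fun t => ?_
    induction t using TensorProduct.induction_on with
    | zero => simp
    | tmul a b =>
      have : ∀ i, ((a * x i * b.unop) ⊗ₜ[R] (1 : Aᵐᵒᵖ)) * e i =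
          (a ⊗ₜ 1) * (((x i * b.unop) ⊗ₜ[R] (1 : Aᵐᵒᵖ)) * e i) := fun i => by
        rw [← mul_assoc, Algebra.TensorProduct.tmul_mul_tmul, mul_one, mul_assoc]
      simp only [AlgHom.mulLeftRight_apply, this, ← Finset.mul_sum, h₃]
      simp
    | add s t hs ht =>
      simp only [map_add, LinearMap.add_apply, TensorProduct.add_tmul, add_mul,
        Finset.sum_add_distrib] at hs ht ⊢
      rw [hs, ht]
  · intro g
    refine ⟨∑ i, (g (x i) ⊗ₜ[R] (1 : Aᵐᵒᵖ)) * e i, ?_⟩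
    ext z
    simp only [map_sum, map_mul, LinearMap.sum_apply, Module.End.mul_apply, h₂,
      AlgHom.mulLeftRight_apply, unop_one, mul_one]
    conv_rhs => rw [← h₁ z, map_sum]
    refine Finset.sum_congr rfl fun i _ => ?_
    rw [← Algebra.commutes, map_smul, Algebra.smul_def]

theorem azumaya_tmul_one_injective (R A M : Type*) [CommRing R] [Ring A] [Algebra R A]
    [IsAzumaya R A] [AddCommGroup M] [Module R M] (m : M) (hm : m ⊗ₜ[R] (1 : A) = 0) : m = 0 := by
  obtain ⟨n, x, f, -, hdual, -⟩ := azumaya_exists_data R A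
  let I : Ideal R := Ideal.span (Set.range fun ij : Fin n × Fin n => f ij.1 (x ij.2))
  have hI : (⊤ : Submodule R A) ≤ I • ⊤ := by
    intro y _
    rw [← hdual y]
    refine Submodule.sum_mem _ fun i _ => Submodule.smul_mem _ _ ?_
    rw [← hdual (x i)]
    exact Submodule.sum_mem _ fun j _ =>
      Submodule.smul_mem_smul (Ideal.subset_span ⟨(j, i), rfl⟩) trivial
  obtain ⟨r, hr, hr0⟩ := Submodule.exists_sub_one_mem_and_smul_eq_zero_of_fg_of_le_smul I ⊤
    Module.Finite.fg_top hI
  have hr' : r = 0 := eq_of_smul_eq_smul (α := A) fun a => by rw [hr0 a trivial, zero_smul]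
  have h1 : (1 : R) ∈ I := by simpa [hr'] using hr
  have hx : ∀ y : A, m ⊗ₜ[R] y = 0 := fun y => by
    have := congrArg (LinearMap.lTensor M (LinearMap.mulLeft R y)) hm
    simpa using this
  have hle : I ≤ Ideal.span {r | r • m = 0} := Ideal.span_mono (by
    rintro _ ⟨⟨i, j⟩, rfl⟩
    have := congrArg (fun t => TensorProduct.rid R M (LinearMap.lTensor M (f i) t)) (hx (x j))
    simpa using this)
  have hann : ∀ r ∈ Ideal.span {r : R | r • m = 0}, r • m = 0 := fun r hr => by
    induction hr using Submodule.span_induction with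
    | mem r h => exact h
    | zero => simp
    | add a b _ _ ha hb => rw [add_smul, ha, hb, add_zero]
    | smul a b _ hb => rw [smul_assoc, hb, smul_zero]
  simpa using hann 1 (hle h1)

section

variable (R S A B : Type*) [CommRing R] [CommRing S] [Algebra R S] [Ring A] [Algebra R A]
  [Ring B] [Algebra S B] [Algebra R B] [IsScalarTower R S B]

/-- The homomorphism `(b ⊗ b') ⊗ (a ⊗ a') ↦ (b ⊗ a) ⊗ (b' ⊗ a')`. -/
noncomputable def shuffle : (B ⊗[S] Bᵐᵒᵖ) ⊗[R] (A ⊗[R] Aᵐᵒᵖ) →ₐ[S]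
    (B ⊗[R] A) ⊗[S] (B ⊗[R] A)ᵐᵒᵖ :=
  (Algebra.TensorProduct.map (AlgHom.id S (B ⊗[R] A))
    (Algebra.TensorProduct.opAlgEquiv R S B A).toAlgHom).comp
  (Algebra.TensorProduct.tensorTensorTensorComm R S R S B Bᵐᵒᵖ A Aᵐᵒᵖ).toAlgHom

theorem shuffle_tmul (b : B) (b' : Bᵐᵒᵖ) (a : A) (a' : Aᵐᵒᵖ) :
    shuffle R S A B ((b ⊗ₜ b') ⊗ₜ (a ⊗ₜ a')) = (b ⊗ₜ a) ⊗ₜ op (b'.unop ⊗ₜ a'.unop) := rfl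

theorem mulLeftRight_shuffle (s : B ⊗[S] Bᵐᵒᵖ) (t : A ⊗[R] Aᵐᵒᵖ) (b : B) (a : A) :
    AlgHom.mulLeftRight S (B ⊗[R] A) (shuffle R S A B (s ⊗ₜ t)) (b ⊗ₜ a) =
      AlgHom.mulLeftRight S B s b ⊗ₜ AlgHom.mulLeftRight R A t a := by
  induction s using TensorProduct.induction_on with
  | zero => simp
  | add s s' hs hs' => simp only [TensorProduct.add_tmul, map_add, LinearMap.add_apply, hs, hs']
  | tmul b₁ b₂ =>
    induction t using TensorProduct.induction_on with
    | zero => simp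
    | add s s' hs hs' => simp only [TensorProduct.tmul_add, map_add, LinearMap.add_apply, hs, hs']
    | tmul a₁ a₂ => simp [shuffle_tmul]

theorem isAzumaya_tensorProduct [IsAzumaya R A] [IsAzumaya S B] : IsAzumaya S (B ⊗[R] A) := by
  have hfaith : FaithfulSMul S (B ⊗[R] A) := by
    rw [faithfulSMul_iff_algebraMap_injective]
    refine (injective_iff_map_eq_zero _).2 fun s hs => ?_
    have h0 : algebraMap S B s = 0 :=
      azumaya_tmul_one_injective R A B _ (by
        rwa [Algebra.TensorProduct.algebraMap_apply] at hs)
    exact (injective_iff_map_eq_zero _).1 (FaithfulSMul.algebraMap_injective S B) s h0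
  obtain ⟨n, x, f, e, h₁, h₂, h₃⟩ := azumaya_exists_data R A
  obtain ⟨m, y, g, d, k₁, k₂, k₃⟩ := azumaya_exists_data S B
  have hproj : Module.Projective S (B ⊗[R] A) := inferInstance
  have hfin : Module.Finite S (B ⊗[R] A) :=
    Module.Finite.equiv (TensorProduct.AlgebraTensorModule.cancelBaseChange R S S B A)
  refine ⟨azumaya_bij_of_data (ι := Fin m × Fin n) S (B ⊗[R] A)
    (fun ji => y ji.1 ⊗ₜ x ji.2)
    (fun ji => (TensorProduct.AlgebraTensorModule.rid R S S).toLinearMap.comp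
      (TensorProduct.AlgebraTensorModule.map (g ji.1) (f ji.2)))
    (fun ji => shuffle R S A B (d ji.1 ⊗ₜ e ji.2)) ?_ ?_ ?_⟩
  · intro z
    induction z using TensorProduct.induction_on with
    | zero => simp
    | add s t hs ht => simp only [map_add, add_smul, Finset.sum_add_distrib] at hs ht ⊢; rw [hs, ht]
    | tmul b a =>
      conv_rhs => rw [← h₁ a, ← k₁ b]
      rw [TensorProduct.sum_tmul, Fintype.sum_prod_type]
      simp only [TensorProduct.tmul_sum]
      refine Finset.sum_congr rfl fun j _ => Finset.sum_congr rfl fun i _ => ?_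
      simp only [LinearMap.comp_apply, TensorProduct.AlgebraTensorModule.map_tmul,
        LinearEquiv.coe_coe, TensorProduct.AlgebraTensorModule.rid_tmul]
      rw [TensorProduct.tmul_smul, smul_assoc, TensorProduct.smul_tmul']
  · rintro ⟨j, i⟩ z
    induction z using TensorProduct.induction_on with
    | zero => simp
    | add s t hs ht => simp only [map_add] at hs ht ⊢; rw [hs, ht]
    | tmul b a =>
      rw [mulLeftRight_shuffle, h₂, k₂]
      simp only [LinearMap.comp_apply, TensorProduct.AlgebraTensorModule.map_tmul,
        LinearEquiv.coe_coe, TensorProduct.AlgebraTensorModule.rid_tmul]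
      rw [Algebra.TensorProduct.algebraMap_apply, Algebra.algebraMap_eq_smul_one (f i a),
        TensorProduct.tmul_smul, TensorProduct.smul_tmul', Algebra.algebraMap_eq_smul_one,
        Algebra.algebraMap_eq_smul_one, smul_assoc]
  · intro z
    induction z using TensorProduct.induction_on with
    | zero => simp
    | add s t hs ht =>
      simp only [mul_add, TensorProduct.add_tmul, add_mul, Finset.sum_add_distrib, op_add,
        TensorProduct.tmul_add] at hs ht ⊢
      rw [hs, ht]
    | tmul b a =>
      have key : ∀ j i, ((y j ⊗ₜ[R] x i * b ⊗ₜ a) ⊗ₜ[S] (1 : (B ⊗[R] A)ᵐᵒᵖ)) *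
          shuffle R S A B (d j ⊗ₜ e i) =
          shuffle R S A B ((((y j * b) ⊗ₜ 1) * d j) ⊗ₜ (((x i * a) ⊗ₜ 1) * e i)) := fun j i => by
        rw [← Algebra.TensorProduct.tmul_mul_tmul, map_mul, shuffle_tmul,
          Algebra.TensorProduct.tmul_mul_tmul]
        rfl
      simp only [key]
      rw [Fintype.sum_prod_type]
      simp only [← map_sum, ← TensorProduct.tmul_sum, ← TensorProduct.sum_tmul, h₃, k₃]
      rfl

end

end Azumaya


/-! ### Quotient of a commutative monoid by a submonoid -/

section Quotient

variable {M : Type*} [CommMonoid M]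

/-- The congruence `m₁ ∼ m₂ ↔ ∃ n₁ n₂ ∈ N, m₁ n₁ = m₂ n₂` on a commutative monoid `M`
attached to a submonoid `N`. -/
def quotCon (N : Submonoid M) : Con M where
  r m₁ m₂ := ∃ n₁ ∈ N, ∃ n₂ ∈ N, m₁ * n₁ = m₂ * n₂
  iseqv :=
    { refl := fun _ => ⟨1, N.one_mem, 1, N.one_mem, rfl⟩
      symm := fun ⟨n₁, h₁, n₂, h₂, h⟩ => ⟨n₂, h₂, n₁, h₁, h.symm⟩
      trans := by
        rintro x y z ⟨n₁, h₁, n₂, h₂, h⟩ ⟨k₁, l₁, k₂, l₂, l⟩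
        refine ⟨n₁ * k₁, N.mul_mem h₁ l₁, k₂ * n₂, N.mul_mem l₂ h₂, ?_⟩
        rw [← mul_assoc, h, mul_right_comm, l, mul_assoc] }
  mul' := by
    rintro w x y z ⟨n₁, h₁, n₂, h₂, h⟩ ⟨k₁, l₁, k₂, l₂, l⟩
    refine ⟨n₁ * k₁, N.mul_mem h₁ l₁, n₂ * k₂, N.mul_mem h₂ l₂, ?_⟩
    rw [mul_mul_mul_comm, h, l, mul_mul_mul_comm]

end Quotient

/-! ### Azumaya algebras and the Brauer monoid -/

/-- An Azumaya algebra over `R`. (Being finitely generated as a module, every Azumaya `R`-algebra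
is isomorphic to one whose carrier lives in the universe of `R`.) -/
structure AzumayaAlg (R : Type u) [CommRing R] where
  carrier : Type u
  [ring : Ring carrier]
  [algebra : Algebra R carrier]
  [azumaya : IsAzumaya R carrier]

attribute [instance] AzumayaAlg.ring AzumayaAlg.algebra AzumayaAlg.azumaya

section Brauer

variable (R : Type u) [CommRing R]

/-- `R` as an Azumaya algebra over itself. -/
def AzumayaAlg.self : AzumayaAlg R := ⟨R⟩

variable {R} in
/-- The tensor product of Azumaya algebras. -/
noncomputable def AzumayaAlg.tensor (A B : AzumayaAlg R) : AzumayaAlg R :=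
  letI := isAzumaya_tensorProduct R R B.carrier A.carrier
  ⟨A.carrier ⊗[R] B.carrier⟩

/-- The matrix algebra `Mₙ(R)`, `n ≥ 1`. -/
def AzumayaAlg.matrix (n : ℕ) [NeZero n] : AzumayaAlg R :=
  letI := IsAzumaya.matrix R (Fin n)
  ⟨Matrix (Fin n) (Fin n) R⟩

/-- Isomorphism of Azumaya `R`-algebras. -/
instance AzumayaAlg.isoSetoid : Setoid (AzumayaAlg R) where
  r A B := Nonempty (A.carrier ≃ₐ[R] B.carrier)
  iseqv := ⟨fun _ => ⟨AlgEquiv.refl⟩, fun ⟨e⟩ => ⟨e.symm⟩, fun ⟨e⟩ ⟨f⟩ => ⟨e.trans f⟩⟩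

/-- The set `MA(R)` of isomorphism classes of Azumaya `R`-algebras. -/
def MA : Type (u + 1) := Quotient (AzumayaAlg.isoSetoid R)

variable {R} in
/-- The isomorphism class of an Azumaya algebra. -/
def MA.mk (A : AzumayaAlg R) : MA R := Quotient.mk _ A

/-- `MA(R)` is a commutative monoid under tensor product. -/
noncomputable instance : CommMonoid (MA R) where
  mul := Quotient.map₂ AzumayaAlg.tensor fun _ _ ⟨e⟩ _ _ ⟨f⟩ =>
    ⟨Algebra.TensorProduct.congr e f⟩
  one := MA.mk (AzumayaAlg.self R)
  mul_assoc := by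
    rintro ⟨A⟩ ⟨B⟩ ⟨C⟩
    exact Quotient.sound ⟨Algebra.TensorProduct.assoc R R R A.carrier B.carrier C.carrier⟩
  mul_comm := by
    rintro ⟨A⟩ ⟨B⟩
    exact Quotient.sound ⟨Algebra.TensorProduct.comm R A.carrier B.carrier⟩
  one_mul := by
    rintro ⟨A⟩
    exact Quotient.sound ⟨Algebra.TensorProduct.lid R A.carrier⟩
  mul_one := by
    rintro ⟨A⟩
    exact Quotient.sound ⟨Algebra.TensorProduct.rid R R A.carrier⟩

/-- `M_m(R) ⊗ M_n(R) ≃ M_{mn}(R)`, the Kronecker product. -/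
noncomputable def kroneckerFin (m n : ℕ) :
    Matrix (Fin m) (Fin m) R ⊗[R] Matrix (Fin n) (Fin n) R ≃ₐ[R]
      Matrix (Fin (m * n)) (Fin (m * n)) R :=
  (Matrix.kroneckerAlgEquiv (Fin m) (Fin n) R).trans (Matrix.reindexAlgEquiv R R finProdFinEquiv)

/-- `R ≃ M₁(R)`. -/
noncomputable def scalarFin : R ≃ₐ[R] Matrix (Fin 1) (Fin 1) R :=
  AlgEquiv.ofBijective (Algebra.ofId R (Matrix (Fin 1) (Fin 1) R))
    ⟨(injective_iff_map_eq_zero _).2 fun r h => by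
        simpa [Algebra.ofId_apply, Matrix.algebraMap_matrix_apply] using congrFun (congrFun h 0) 0,
      fun X => ⟨X 0 0, by
        ext i j
        simp [Algebra.ofId_apply, Matrix.algebraMap_matrix_apply, Subsingleton.elim i 0,
          Subsingleton.elim j 0]⟩⟩

theorem scalarFin_apply (r : R) :
    scalarFin R r = algebraMap R (Matrix (Fin 1) (Fin 1) R) r := rfl

/-- The submonoid `MM(R)` of `MA(R)` of isomorphism classes of matrix algebras. -/
noncomputable def MM : Submonoid (MA R) where
  carrier := {x | ∃ (n : ℕ) (_ : NeZero n), x = MA.mk (AzumayaAlg.matrix R n)}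
  one_mem' := ⟨1, inferInstance, Quotient.sound ⟨scalarFin R⟩⟩
  mul_mem' := by
    rintro _ _ ⟨m, _, rfl⟩ ⟨n, _, rfl⟩
    exact ⟨m * n, inferInstance, Quotient.sound ⟨kroneckerFin R m n⟩⟩

/-- The Brauer monoid `BM(R) = MA(R) / MM(R)`. -/
def BM : Type (u + 1) := (quotCon (MM R)).Quotient

noncomputable instance : CommMonoid (BM R) := inferInstanceAs (CommMonoid (quotCon (MM R)).Quotient)

variable {R} in
/-- The class of an Azumaya algebra in the Brauer monoid. -/
noncomputable def BM.mk (A : AzumayaAlg R) : BM R := ((MA.mk A : MA R) : (quotCon (MM R)).Quotient)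

end Brauer

/-! ### Differential Azumaya algebras and the differential Brauer monoid -/

/-- A derivation of the (not necessarily commutative) `R`-algebra `A` which extends the
derivation of the differential ring `R`. -/
structure ExtDerivation (R A : Type*) [CommRing R] [Differential R] [Ring A] [Algebra R A]
    extends A →+ A where
  leibniz' : ∀ a b, toFun (a * b) = toFun a * b + a * toFun b
  map_algebraMap' : ∀ r : R, toFun (algebraMap R A r) = algebraMap R A ((Differential.deriv r))

namespace ExtDerivation

variable {R A B : Type*} [CommRing R] [Differential R] [Ring A] [Algebra R A] [Ring B] [Algebra R B]

instance : FunLike (ExtDerivation R A) A A where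
  coe d := d.toFun
  coe_injective := fun d d' h => by
    cases d; cases d'; congr; exact DFunLike.coe_injective h

instance : AddMonoidHomClass (ExtDerivation R A) A A where
  map_add d := d.map_add'
  map_zero d := d.map_zero'

theorem leibniz (d : ExtDerivation R A) (a b : A) : d (a * b) = d a * b + a * d b :=
  d.leibniz' a b

theorem map_algebraMap (d : ExtDerivation R A) (r : R) :
    d (algebraMap R A r) = algebraMap R A ((Differential.deriv r)) := d.map_algebraMap' r

theorem deriv_smul (d : ExtDerivation R A) (r : R) (a : A) : d (r • a) = (Differential.deriv r) • a + r • d a := by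
  rw [Algebra.smul_def, leibniz, map_algebraMap, Algebra.smul_def, Algebra.smul_def]

/-- The derivation of `R`. -/
def self (R : Type*) [CommRing R] [Differential R] : ExtDerivation R R where
  toFun r := Differential.deriv r
  map_zero' := map_zero _
  map_add' := map_add _
  leibniz' a b := by
    change (Differential.deriv (a * b)) = _
    rw [Derivation.leibniz, smul_eq_mul, smul_eq_mul]; ring
  map_algebraMap' _ := rfl

/-- The additive map `D_A ⊗ 1 + 1 ⊗ D_B` of `A ⊗ B`. -/
noncomputable def tensorAddHom (d : ExtDerivation R A) (d' : ExtDerivation R B) :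
    A ⊗[R] B →+ A ⊗[R] B :=
  TensorProduct.liftAddHom
    (AddMonoidHom.mk' (fun a => AddMonoidHom.mk' (fun b => d a ⊗ₜ[R] b + a ⊗ₜ[R] d' b)
      (fun b b' => by rw [map_add, TensorProduct.tmul_add, TensorProduct.tmul_add]; abel))
      (fun a a' => by
        ext b
        simp only [AddMonoidHom.mk'_apply, AddMonoidHom.add_apply, map_add,
          TensorProduct.add_tmul]
        abel))
    (fun r a b => by
      simp only [AddMonoidHom.mk'_apply, deriv_smul, TensorProduct.add_tmul,
        TensorProduct.tmul_add, TensorProduct.smul_tmul]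
      abel)

theorem tensorAddHom_tmul (d : ExtDerivation R A) (d' : ExtDerivation R B) (a : A) (b : B) :
    d.tensorAddHom d' (a ⊗ₜ b) = d a ⊗ₜ b + a ⊗ₜ d' b := rfl

theorem tensorAddHom_mul (d : ExtDerivation R A) (d' : ExtDerivation R B) (x y : A ⊗[R] B) :
    d.tensorAddHom d' (x * y) = d.tensorAddHom d' x * y + x * d.tensorAddHom d' y := by
  induction x using TensorProduct.induction_on with
  | zero => simp
  | add s t hs ht => rw [add_mul, map_add, hs, ht, map_add, add_mul, add_mul]; abel
  | tmul a b =>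
    induction y using TensorProduct.induction_on with
    | zero => simp
    | add s t hs ht => rw [mul_add, map_add, hs, ht, map_add, mul_add, mul_add]; abel
    | tmul a' b' =>
      simp only [Algebra.TensorProduct.tmul_mul_tmul, tensorAddHom_tmul, leibniz, add_mul, mul_add,
        TensorProduct.add_tmul, TensorProduct.tmul_add]
      abel

theorem map_one_eq_zero (d : ExtDerivation R A) : d 1 = 0 := by
  have := d.map_algebraMap 1
  rwa [map_one, Derivation.map_one_eq_zero, map_zero] at this

/-- The derivation `D_A ⊗ 1 + 1 ⊗ D_B` of `A ⊗ B`. -/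
noncomputable def tensor (d : ExtDerivation R A) (d' : ExtDerivation R B) :
    ExtDerivation R (A ⊗[R] B) where
  toAddMonoidHom := d.tensorAddHom d'
  leibniz' := d.tensorAddHom_mul d'
  map_algebraMap' r := by
    change d.tensorAddHom d' (algebraMap R A r ⊗ₜ[R] (1 : B)) = _
    rw [tensorAddHom_tmul, map_algebraMap, map_one_eq_zero, TensorProduct.tmul_zero, add_zero]
    rfl

theorem tensor_tmul (d : ExtDerivation R A) (d' : ExtDerivation R B) (a : A) (b : B) :
    d.tensor d' (a ⊗ₜ b) = d a ⊗ₜ b + a ⊗ₜ d' b := rfl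

/-- The entrywise derivation of `Mₙ(R)`. -/
def matrix (R : Type*) [CommRing R] [Differential R] (n : ℕ) :
    ExtDerivation R (Matrix (Fin n) (Fin n) R) where
  toFun X := X.map (fun r => Differential.deriv r)
  map_zero' := by ext; simp
  map_add' X Y := by ext; simp
  leibniz' X Y := by
    ext i j
    simp only [Matrix.map_apply, Matrix.mul_apply, Matrix.add_apply, map_sum, Derivation.leibniz,
      smul_eq_mul, Finset.sum_add_distrib]
    rw [add_comm]
    congr 1
    exact Finset.sum_congr rfl fun k _ => mul_comm _ _
  map_algebraMap' r := by
    ext i j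
    by_cases h : i = j <;> simp [Matrix.algebraMap_matrix_apply, h]

end ExtDerivation

/-- A differential Azumaya algebra over the differential ring `R`. -/
structure DiffAzumayaAlg (R : Type u) [CommRing R] [Differential R] extends AzumayaAlg R where
  D : ExtDerivation R carrier

section DiffBrauer

variable (R : Type u) [CommRing R] [Differential R]

/-- `R` as a differential Azumaya algebra over itself. -/
def DiffAzumayaAlg.self : DiffAzumayaAlg R := ⟨AzumayaAlg.self R, ExtDerivation.self R⟩

variable {R} in
/-- The tensor product of differential Azumaya algebras. -/
noncomputable def DiffAzumayaAlg.tensor (A B : DiffAzumayaAlg R) : DiffAzumayaAlg R :=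
  ⟨A.toAzumayaAlg.tensor B.toAzumayaAlg, A.D.tensor B.D⟩

/-- `(Mₙ(R), 0)`: the matrix algebra `Mₙ(R)`, `n ≥ 1`, with the entrywise derivation. -/
def DiffAzumayaAlg.matrix (n : ℕ) [NeZero n] : DiffAzumayaAlg R :=
  ⟨AzumayaAlg.matrix R n, ExtDerivation.matrix R n⟩

variable {R} in
/-- `A` and `B` are isomorphic as differential `R`-algebras. -/
def DiffAzumayaAlg.Iso (A B : DiffAzumayaAlg R) : Prop :=
  ∃ e : A.carrier ≃ₐ[R] B.carrier, ∀ a, e (A.D a) = B.D (e a)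

/-- Isomorphism of differential Azumaya `R`-algebras. -/
instance DiffAzumayaAlg.isoSetoid : Setoid (DiffAzumayaAlg R) where
  r := DiffAzumayaAlg.Iso
  iseqv :=
    { refl := fun _ => ⟨AlgEquiv.refl, fun _ => rfl⟩
      symm := fun ⟨e, he⟩ => ⟨e.symm, fun b => by
        rw [AlgEquiv.symm_apply_eq, he, AlgEquiv.apply_symm_apply]⟩
      trans := fun ⟨e, he⟩ ⟨f, hf⟩ => ⟨e.trans f, fun a => by
        rw [AlgEquiv.trans_apply, AlgEquiv.trans_apply, he, hf]⟩ }

/-- The set `MA^diff(R)` of isomorphism classes of differential Azumaya `R`-algebras. -/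
def MAdiff : Type (u + 1) := Quotient (DiffAzumayaAlg.isoSetoid R)

variable {R} in
/-- The isomorphism class of a differential Azumaya algebra. -/
def MAdiff.mk (A : DiffAzumayaAlg R) : MAdiff R := Quotient.mk _ A

variable {R} in
/-- An isomorphism out of a tensor product is differential as soon as it is so on pure tensors. -/
theorem tensor_iso (A B C : DiffAzumayaAlg R)
    (e : A.carrier ⊗[R] B.carrier ≃ₐ[R] C.carrier)
    (h : ∀ a b, e (A.D a ⊗ₜ b) + e (a ⊗ₜ B.D b) = C.D (e (a ⊗ₜ b))) : (A.tensor B).Iso C := by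
  have H : ∀ x : A.carrier ⊗[R] B.carrier, e (A.D.tensor B.D x) = C.D (e x) := by
    intro x
    induction x using TensorProduct.induction_on with
    | zero => simp
    | add s t hs ht => rw [map_add, map_add, hs, ht, ← map_add, ← map_add]
    | tmul a b => rw [ExtDerivation.tensor_tmul, map_add, h]
  exact ⟨e, H⟩

/-- `MA^diff(R)` is a commutative monoid under tensor product. -/
noncomputable instance : CommMonoid (MAdiff R) where
  mul := Quotient.map₂ DiffAzumayaAlg.tensor fun A A' ⟨e, he⟩ B B' ⟨f, hf⟩ =>
    tensor_iso _ _ (A'.tensor B') (Algebra.TensorProduct.congr e f) fun a b => by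
      change _ = A'.D.tensor B'.D (e a ⊗ₜ f b)
      rw [ExtDerivation.tensor_tmul, ← he, ← hf]
      rfl
  one := MAdiff.mk (DiffAzumayaAlg.self R)
  mul_assoc := by
    rintro ⟨A⟩ ⟨B⟩ ⟨C⟩
    refine Quotient.sound (tensor_iso (A.tensor B) C (A.tensor (B.tensor C))
      (Algebra.TensorProduct.assoc R R R A.carrier B.carrier C.carrier) fun x c => ?_)
    let e := Algebra.TensorProduct.assoc R R R A.carrier B.carrier C.carrier
    change e (A.D.tensor B.D x ⊗ₜ c) + e (x ⊗ₜ C.D c) =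
      A.D.tensor (B.D.tensor C.D) (e (x ⊗ₜ c))
    induction x using TensorProduct.induction_on with
    | zero => simp
    | add s t hs ht =>
      simp only [map_add, TensorProduct.add_tmul] at hs ht ⊢
      rw [← hs, ← ht]; abel
    | tmul a b =>
      simp only [e, ExtDerivation.tensor_tmul, Algebra.TensorProduct.assoc_tmul,
        TensorProduct.add_tmul, TensorProduct.tmul_add, map_add]
      abel
  mul_comm := by
    rintro ⟨A⟩ ⟨B⟩
    refine Quotient.sound (tensor_iso A B (B.tensor A)
      (Algebra.TensorProduct.comm R A.carrier B.carrier) fun a b => ?_)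
    change _ = B.D.tensor A.D (b ⊗ₜ a)
    rw [ExtDerivation.tensor_tmul, add_comm]
    rfl
  one_mul := by
    rintro ⟨A⟩
    refine Quotient.sound (tensor_iso (.self R) A A
      (Algebra.TensorProduct.lid R A.carrier) fun r a => ?_)
    exact (A.D.deriv_smul r a).symm
  mul_one := by
    rintro ⟨A⟩
    refine Quotient.sound (tensor_iso A (.self R) A
      (Algebra.TensorProduct.rid R R A.carrier) fun a r => ?_)
    rw [add_comm]
    exact (A.D.deriv_smul r a).symm

theorem scalarFin_deriv (r : R) :
    scalarFin R (ExtDerivation.self R r) = ExtDerivation.matrix R 1 (scalarFin R r) := by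
  rw [scalarFin_apply, scalarFin_apply, ExtDerivation.map_algebraMap]
  rfl

/-- The submonoid `MM₀^diff(R)` of `MA^diff(R)` of isomorphism classes of the differential
matrix algebras `(Mₙ(R), 0)`. -/
noncomputable def MMdiff₀ : Submonoid (MAdiff R) where
  carrier := {x | ∃ (n : ℕ) (_ : NeZero n), x = MAdiff.mk (DiffAzumayaAlg.matrix R n)}
  one_mem' := ⟨1, inferInstance, Quotient.sound
    ⟨scalarFin R, scalarFin_deriv R⟩⟩
  mul_mem' := by
    rintro _ _ ⟨m, _, rfl⟩ ⟨n, _, rfl⟩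
    refine ⟨m * n, inferInstance, Quotient.sound (tensor_iso (.matrix R m) (.matrix R n)
      (.matrix R (m * n)) (kroneckerFin R m n) fun X Y => ?_)⟩
    refine Matrix.ext fun i j => ?_
    change Differential.deriv (X _ _) * Y _ _ + X _ _ * Differential.deriv (Y _ _) =
      Differential.deriv (X _ _ * Y _ _)
    rw [Derivation.leibniz, smul_eq_mul, smul_eq_mul]
    ring

/-- The differential Brauer monoid `BM^diff(R) = MA^diff(R) / MM₀^diff(R)`. -/
def BMdiff : Type (u + 1) := (quotCon (MMdiff₀ R)).Quotient

noncomputable instance : CommMonoid (BMdiff R) :=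
  inferInstanceAs (CommMonoid (quotCon (MMdiff₀ R)).Quotient)

variable {R} in
/-- The class of a differential Azumaya algebra in the differential Brauer monoid. -/
noncomputable def BMdiff.mk (A : DiffAzumayaAlg R) : BMdiff R :=
  ((MAdiff.mk A : MAdiff R) : (quotCon (MMdiff₀ R)).Quotient)

/-- The ring of constants `R^D`. -/
def constants : Subring R where
  carrier := {r | (Differential.deriv r) = 0}
  mul_mem' {a b} ha hb := by
    change (Differential.deriv (a * b)) = 0
    rw [Derivation.leibniz, show (Differential.deriv a) = 0 from ha, show (Differential.deriv b) = 0 from hb, smul_zero, smul_zero,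
      add_zero]
  one_mem' := Derivation.map_one_eq_zero _
  add_mem' {a b} ha hb := by
    change (Differential.deriv (a + b)) = 0
    rw [map_add, show (Differential.deriv a) = 0 from ha, show (Differential.deriv b) = 0 from hb, add_zero]
  zero_mem' := map_zero _
  neg_mem' {a} ha := by
    change (Differential.deriv (-a)) = 0
    rw [map_neg, show (Differential.deriv a) = 0 from ha, neg_zero]

/-- The derivation of `R`, as an `R^D`-linear map. -/
def derivLinear : R →ₗ[constants R] R where
  toFun r := Differential.deriv r
  map_add' := map_add _
  map_smul' c r := by
    rw [Subring.smul_def, smul_eq_mul, Derivation.leibniz, show (Differential.deriv (c : R)) = 0 from c.2, smul_zero,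
      add_zero]
    rfl

/-- The derivation `D_R ⊗ 1` of `R ⊗_{R^D} A₀`. -/
noncomputable def inducedDerivation (A₀ : Type*) [Ring A₀] [Algebra (constants R) A₀] :
    ExtDerivation R (R ⊗[constants R] A₀) where
  toAddMonoidHom := ((derivLinear R).rTensor A₀).toAddMonoidHom
  leibniz' x y := by
    change (derivLinear R).rTensor A₀ _ = (derivLinear R).rTensor A₀ _ * y +
      x * (derivLinear R).rTensor A₀ _
    induction x using TensorProduct.induction_on with
    | zero => simp
    | add s t hs ht => rw [add_mul, map_add, hs, ht, map_add, add_mul, add_mul]; abel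
    | tmul r a =>
      induction y using TensorProduct.induction_on with
      | zero => simp
      | add s t hs ht => rw [mul_add, map_add, hs, ht, map_add, mul_add, mul_add]; abel
      | tmul r' a' =>
        simp only [Algebra.TensorProduct.tmul_mul_tmul, LinearMap.rTensor_tmul]
        rw [← TensorProduct.add_tmul]
        congr 1
        exact (ExtDerivation.self R).leibniz r r'
  map_algebraMap' r := by
    change (derivLinear R).rTensor A₀ (r ⊗ₜ 1) = Differential.deriv r ⊗ₜ 1
    rfl

variable {R} in
/-- The differential Azumaya `R`-algebra `R ⊗_{R^D} A₀` induced by an Azumaya `R^D`-algebra. -/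
noncomputable def induced (A₀ : AzumayaAlg (constants R)) : DiffAzumayaAlg R :=
  letI := isAzumaya_tensorProduct (constants R) R A₀.carrier R
  ⟨⟨R ⊗[constants R] A₀.carrier⟩, inducedDerivation R A₀.carrier⟩

end DiffBrauer

end DiffBrauer

/-!
# The units of the differential Brauer monoid

Write `S = R^D`. The statement has three parts.

*`BM(S)` is a group.* It suffices to find, for an Azumaya `S`-algebra `A`, a unital homomorphism
`A → Mₙ(S)` with `n ≥ 1` (`hasMatrixRep_of_isAzumaya`): `Mₙ(S)` is then the tensor product of `A`
with the centralizer of `A` (`centralizerMul_bijective`), and a tensor factor of a matrix algebra is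
Azumaya (`isAzumaya_of_tensorProduct_equiv_matrix`). As `A` acts on itself, one may represent
`E = End_S A` instead. Locally on `Spec S` the module `A` is free and `E` is a matrix algebra, so
the point is to glue representations `ρ₁` over `T[1/f]` and `ρ₂` over `T[1/g]`, where `f` and `g`
are comaximal (`HasMatrixRep.glue`). The exchange of the two factors of `A ⊗ A` is an involution
`e ∈ E ⊗ E` (`exchange`), and `u = (ρ₁ ⊗ ρ₂)(e)` conjugates `ρ₁ ⊗ 1` to `1 ⊗ ρ₂` over `T[1/fg]`.
Since `u = u⁻¹`, Whitehead's lemma makes `diag(u, u)` a product of elementary matrices, hence a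
product `φ γ` of an invertible matrix over `T[1/f]` and one over `T[1/g]`
(`splits_fromBlocks_of_involution`). Conjugating by `φ` and `γ` makes the doubled representations
agree over `T[1/fg]`, so that they come from `T`.

*Injectivity.* An Azumaya `S`-algebra `A₀` is flat, so the constants of `R ⊗ A₀` are `A₀`. A
differential isomorphism between induced algebras thus restricts to one between the algebras
themselves (`nonempty_algEquiv_of_induced`); apply this to tensor products with matrix algebras.

*Surjectivity onto the units.* If the class of `A` is a unit, there is a differential isomorphism
`A ⊗ B ≃ Mₘ(R)` with the entrywise derivation on the right. The functional `b ↦ (1 ⊗ b)₀₀` on `B`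
is horizontal and takes `1` to `1`, so it makes `A` a horizontal retract of `Mₘ(R)`. As `Mₘ(R)` is
generated by constants, so is `A`, and `A = R ⊗ A^D` with `A^D` projective
(`projective_and_constantsMul_bijective`). Taking constants gives `A^D ⊗ B^D ≃ Mₘ(S)`, so `A^D` is
Azumaya (`isAzumaya_constantSubalgebra`).
-/

namespace DiffBrauer

/-! ### Factorization of elementary matrices over an intersection of two basic opens -/

section Localization

variable {R R' : Type*} [CommRing R] [CommRing R'] [Algebra R R'] (r : R)
  [IsLocalization.Away r R'] {m n : Type*} [Finite m] [Finite n]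

theorem exists_pow_smul_eq_map (X : Matrix m n R') :
    ∃ (k : ℕ) (Y : Matrix m n R), algebraMap R R' r ^ k • X = Y.map (algebraMap R R') := by
  obtain ⟨⟨_, k, rfl⟩, hb⟩ := IsLocalization.exist_integer_multiples_of_finite
    (Submonoid.powers r) (fun ij : m × n => X ij.1 ij.2)
  choose Y hY using hb
  refine ⟨k, Matrix.of fun i j => Y (i, j), ?_⟩
  ext i j
  simp [hY, Algebra.smul_def]

theorem exists_pow_smul_eq_zero (Y : Matrix m n R) (hY : Y.map (algebraMap R R') = 0) :
    ∃ k : ℕ, r ^ k • Y = 0 := by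
  have := Fintype.ofFinite m
  have := Fintype.ofFinite n
  have h : ∀ ij : m × n, ∃ k : ℕ, r ^ k * Y ij.1 ij.2 = 0 := fun ij => by
    obtain ⟨k, hk⟩ := IsLocalization.Away.exists_of_eq (S := R') r (a := Y ij.1 ij.2) (b := 0) (by
      simpa using congrFun (congrFun hY ij.1) ij.2)
    exact ⟨k, by simpa using hk⟩
  choose k hk using h
  refine ⟨∑ ij, k ij, ?_⟩
  ext i j
  have hle : k (i, j) ≤ ∑ ij, k ij := Finset.single_le_sum (fun _ _ => Nat.zero_le _)
    (Finset.mem_univ (i, j))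
  rw [Matrix.smul_apply, smul_eq_mul, ← Nat.sub_add_cancel hle, pow_add, mul_assoc, hk (i, j),
    mul_zero, Matrix.zero_apply]

end Localization

section Splitting

variable {T T₁ T₂ T₃ : Type*} [CommRing T] [CommRing T₁] [CommRing T₂] [CommRing T₃]
  [Algebra T T₁] [Algebra T T₂] [Algebra T T₃] [Algebra T₁ T₃] [Algebra T₂ T₃]
  [IsScalarTower T T₁ T₃] [IsScalarTower T T₂ T₃]
  {n : Type*} [Fintype n] [DecidableEq n]

variable (T₁ T₂) in
/-- An invertible matrix over `T₃` splits if it is the product of (the image of) an invertible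
matrix over `T₁` and an invertible matrix over `T₂`. For `T₁ = T[1/f]`, `T₂ = T[1/g]` and
`T₃ = T[1/fg]`, with `f` and `g` comaximal, this says that the vector bundle with clutching
function `u` is trivial. -/
def Splits (u : Matrix n n T₃) : Prop :=
  ∃ (φ : (Matrix n n T₁)ˣ) (γ : (Matrix n n T₂)ˣ),
    u = (algebraMap T₁ T₃).mapMatrix φ * (algebraMap T₂ T₃).mapMatrix γ

theorem Splits.one : Splits T₁ T₂ (1 : Matrix n n T₃) := ⟨1, 1, by simp⟩

theorem Splits.mul_right {u : Matrix n n T₃} (hu : Splits T₁ T₂ u) (γ : (Matrix n n T₂)ˣ) :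
    Splits T₁ T₂ (u * (algebraMap T₂ T₃).mapMatrix γ) := by
  obtain ⟨φ, γ', rfl⟩ := hu
  exact ⟨φ, γ' * γ, by rw [Units.val_mul, map_mul, mul_assoc]⟩

theorem map_fromBlocks_corner {R R' : Type*} [CommRing R] [CommRing R'] (h : R →+* R')
    (z : Matrix n n R) :
    h.mapMatrix (Matrix.fromBlocks 0 z 0 0 : Matrix (n ⊕ n) (n ⊕ n) R) =
      Matrix.fromBlocks 0 (h.mapMatrix z) 0 0 := by
  simp [RingHom.mapMatrix_apply, Matrix.fromBlocks_map, Matrix.map_zero]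

/-- The unipotent matrix `1 + X` attached to a matrix `X` of square zero. -/
def oneAddUnit {B : Type*} [Ring B] (X : B) (hX : X * X = 0) : Bˣ where
  val := 1 + X
  inv := 1 - X
  val_inv := by simp [add_mul, mul_sub, hX]
  inv_val := by simp [sub_mul, mul_add, hX]

variable (f g : T) [IsLocalization.Away (algebraMap T T₁ g) T₃]
  [IsLocalization.Away (algebraMap T T₂ f) T₃]

/-- Splitting matrices are stable under multiplication by elementary block matrices. -/
theorem Splits.mul_corner (hfg : IsCoprime f g) {v : Matrix (n ⊕ n) (n ⊕ n) T₃}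
    (hv : Splits T₁ T₂ v) (z : Matrix n n T₃) :
    Splits T₁ T₂ (v * (1 + Matrix.fromBlocks 0 z 0 0)) := by
  obtain ⟨φ, γ, rfl⟩ := hv
  obtain ⟨k₁, s, hs⟩ := exists_pow_smul_eq_map (algebraMap T T₁ g) z
  obtain ⟨k₂, p, hp⟩ := exists_pow_smul_eq_map (algebraMap T T₂ f) z
  rw [← IsScalarTower.algebraMap_apply] at hs hp
  let E₁ : Matrix (n ⊕ n) (n ⊕ n) T₁ := Matrix.fromBlocks 0 s 0 0
  let E₂ : Matrix (n ⊕ n) (n ⊕ n) T₂ := Matrix.fromBlocks 0 p 0 0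
  let Z : Matrix (n ⊕ n) (n ⊕ n) T₃ := Matrix.fromBlocks 0 z 0 0
  let ι₁ := (algebraMap T₁ T₃).mapMatrix (m := n ⊕ n)
  let ι₂ := (algebraMap T₂ T₃).mapMatrix (m := n ⊕ n)
  have hE₁ : ι₁ E₁ = algebraMap T T₃ g ^ k₁ • Z := by
    simp only [ι₁, E₁, Z]
    rw [map_fromBlocks_corner, RingHom.mapMatrix_apply, ← hs, Matrix.fromBlocks_smul]
    simp
  have hE₂ : ι₂ E₂ = algebraMap T T₃ f ^ k₂ • Z := by
    simp only [ι₂, E₂, Z]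
    rw [map_fromBlocks_corner, RingHom.mapMatrix_apply, ← hp, Matrix.fromBlocks_smul]
    simp
  have hZ : Z * Z = 0 := by simp [Z, Matrix.fromBlocks_multiply]
  have hE₂' : E₂ * E₂ = 0 := by simp [E₂, Matrix.fromBlocks_multiply]
  -- `Y` lifts a multiple of the conjugate `γ E₁ γ⁻¹`; it has square zero up to a power of `g`.
  obtain ⟨c, Y, hY⟩ := exists_pow_smul_eq_map (algebraMap T T₁ g)
    (ι₂ γ * ι₁ E₁ * ι₂ (γ⁻¹ : (Matrix (n ⊕ n) (n ⊕ n) T₂)ˣ))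
  have hγ : ι₂ (γ⁻¹ : (Matrix (n ⊕ n) (n ⊕ n) T₂)ˣ) * ι₂ γ = 1 := by
    rw [← map_mul, Units.inv_mul, map_one]
  rw [← IsScalarTower.algebraMap_apply] at hY
  change _ = ι₁ Y at hY
  obtain ⟨d, hd⟩ := exists_pow_smul_eq_zero (R' := T₃) (algebraMap T T₁ g) (Y * Y) (by
    change ι₁ _ = 0
    rw [map_mul, ← hY, smul_mul_smul_comm]
    have : ι₂ γ * ι₁ E₁ * ι₂ (γ⁻¹ : (Matrix (n ⊕ n) (n ⊕ n) T₂)ˣ) *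
        (ι₂ γ * ι₁ E₁ * ι₂ (γ⁻¹ : (Matrix (n ⊕ n) (n ⊕ n) T₂)ˣ)) = 0 := by
      simp only [mul_assoc]
      rw [← mul_assoc _ (ι₂ γ), hγ, one_mul, ← mul_assoc (ι₁ E₁), hE₁, smul_mul_smul_comm, hZ]
      simp
    rw [this, smul_zero])
  -- Write `Z = α Z + β Z`, where `α Z` is defined over `T₂` since `f ^ k₂ ∣ α`, and where
  -- `g ^ (k₁ + c + d) ∣ β` makes `γ (β Z) γ⁻¹` lift to a matrix of square zero over `T₁`.
  obtain ⟨a, b, hab⟩ := (hfg.pow (m := k₂) (n := k₁ + (c + d)))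
  have hX₁ : (algebraMap T T₁ (b * g ^ d) • Y) * (algebraMap T T₁ (b * g ^ d) • Y) = 0 := by
    rw [smul_mul_smul_comm, ← map_mul, show b * g ^ d * (b * g ^ d) = b * b * g ^ d * g ^ d by ring,
      map_mul, mul_smul, map_pow, hd, smul_zero]
  have hX₂ : (algebraMap T T₂ a • E₂) * (algebraMap T T₂ a • E₂) = 0 := by
    rw [smul_mul_smul_comm, hE₂', smul_zero]
  refine ⟨φ * oneAddUnit _ hX₁, γ * oneAddUnit _ hX₂, ?_⟩
  change ι₁ φ * ι₂ γ * (1 + Z) = ι₁ (φ * (1 + algebraMap T T₁ (b * g ^ d) • Y)) *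
    ι₂ (γ * (1 + algebraMap T T₂ a • E₂))
  have h₁ : ι₁ (algebraMap T T₁ (b * g ^ d) • Y) =
      ι₂ γ * (algebraMap T T₃ (b * g ^ (k₁ + (c + d))) • Z) *
        ι₂ (γ⁻¹ : (Matrix (n ⊕ n) (n ⊕ n) T₂)ˣ) := by
    have : ι₁ (algebraMap T T₁ (b * g ^ d) • Y) = algebraMap T T₃ (b * g ^ d) • ι₁ Y := by
      ext i j
      simp [ι₁, ← IsScalarTower.algebraMap_apply]
    rw [this, ← hY, hE₁, mul_smul_comm, smul_mul_assoc, mul_smul_comm, smul_mul_assoc, smul_smul,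
      smul_smul]
    congr 1
    simp only [map_mul, map_pow]
    ring
  have h₂ : ι₂ (algebraMap T T₂ a • E₂) = algebraMap T T₃ (a * f ^ k₂) • Z := by
    have : ι₂ (algebraMap T T₂ a • E₂) = algebraMap T T₃ a • ι₂ E₂ := by
      ext i j
      simp only [ι₂, RingHom.mapMatrix_apply, Matrix.map_apply, Matrix.smul_apply, smul_eq_mul,
        map_mul, ← IsScalarTower.algebraMap_apply]
    rw [this, hE₂, smul_smul, ← map_pow, ← map_mul]
  have h₃ : Z = algebraMap T T₃ (a * f ^ k₂) • Z + algebraMap T T₃ (b * g ^ (k₁ + (c + d))) • Z := by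
    rw [← add_smul, ← map_add, hab, map_one, one_smul]
  rw [map_mul ι₁, map_add ι₁, map_one ι₁, h₁, map_mul ι₂, map_add ι₂, map_one ι₂, h₂]
  generalize algebraMap T T₃ (a * f ^ k₂) = α at *
  generalize algebraMap T T₃ (b * g ^ (k₁ + (c + d))) = β at *
  have h₄ : ι₂ γ * (β • Z) * ι₂ (γ⁻¹ : (Matrix (n ⊕ n) (n ⊕ n) T₂)ˣ) * ι₂ γ = ι₂ γ * (β • Z) := by
    rw [mul_assoc, hγ, mul_one]
  have h₅ : (β • Z) * (α • Z) = 0 := by rw [smul_mul_smul_comm, hZ, smul_zero]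
  have h₆ : (1 + ι₂ γ * (β • Z) * ι₂ (γ⁻¹ : (Matrix (n ⊕ n) (n ⊕ n) T₂)ˣ)) * (ι₂ γ * (1 + α • Z)) =
      ι₂ γ * (1 + Z) := by
    rw [← mul_assoc, add_mul, one_mul, h₄, ← mul_one_add, mul_assoc, mul_add, mul_one, add_mul,
      one_mul, h₅, add_zero]
    conv_rhs => rw [h₃]
    congr 1
    abel
  rw [mul_assoc (ι₁ φ), mul_assoc (ι₁ φ), h₆]

/-- The block matrix with rows `(0, -1)` and `(1, 0)`. -/
def quarterTurn (R : Type*) [CommRing R] (n : Type*) [Fintype n] [DecidableEq n] :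
    (Matrix (n ⊕ n) (n ⊕ n) R)ˣ where
  val := Matrix.fromBlocks 0 (-1) 1 0
  inv := Matrix.fromBlocks 0 1 (-1) 0
  val_inv := by simp [Matrix.fromBlocks_multiply]
  inv_val := by simp [Matrix.fromBlocks_multiply]

/-- Twice an involution splits: for `u = u⁻¹` the matrix `diag(u, u) = diag(u, u⁻¹)` is a product
of elementary matrices, by Whitehead's lemma. -/
theorem splits_fromBlocks_of_involution (hfg : IsCoprime f g) (u : Matrix n n T₃)
    (hu : u * u = 1) : Splits T₁ T₂ (Matrix.fromBlocks u 0 0 u) := by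
  have hq : (algebraMap T₂ T₃).mapMatrix (quarterTurn T₂ n : Matrix (n ⊕ n) (n ⊕ n) T₂) =
      Matrix.fromBlocks 0 (-1) 1 0 := by
    simp [quarterTurn, Matrix.fromBlocks_map, Matrix.map_zero, Matrix.map_neg]
  have hq' : (algebraMap T₂ T₃).mapMatrix
      ((quarterTurn T₂ n)⁻¹ : (Matrix (n ⊕ n) (n ⊕ n) T₂)ˣ).val =
      Matrix.fromBlocks 0 1 (-1) 0 := by
    change (algebraMap T₂ T₃).mapMatrix (Matrix.fromBlocks 0 1 (-1) 0) = _
    simp [Matrix.fromBlocks_map, Matrix.map_zero, Matrix.map_neg]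
  -- `diag(u, u)` is the product of `1 + u E₁₂`, `w`, `1 + u E₁₂`, `w⁻¹`, `1 + u E₁₂` and `w`,
  -- where `w` is the quarter turn.
  have key := ((((((Splits.one (T₁ := T₁) (T₂ := T₂) (n := n ⊕ n)).mul_corner f g hfg u).mul_right
    (quarterTurn T₂ n)).mul_corner f g hfg u).mul_right (quarterTurn T₂ n)⁻¹).mul_corner
    f g hfg u).mul_right (quarterTurn T₂ n)
  rw [hq, hq'] at key
  convert key using 1
  rw [one_mul, show (1 : Matrix (n ⊕ n) (n ⊕ n) T₃) = Matrix.fromBlocks 1 0 0 1 from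
    Matrix.fromBlocks_one.symm]
  simp [Matrix.fromBlocks_multiply, Matrix.fromBlocks_add, hu, -Matrix.fromBlocks_one]

end Splitting

/-! ### Gluing along two comaximal elements -/

section Gluing

variable {T T₁ T₂ T₃ : Type*} [CommRing T] [CommRing T₁] [CommRing T₂] [CommRing T₃]
  [Algebra T T₁] [Algebra T T₂] [Algebra T T₃] [Algebra T₁ T₃] [Algebra T₂ T₃]
  [IsScalarTower T T₁ T₃] [IsScalarTower T T₂ T₃] (f g : T)
  [IsLocalization.Away f T₁] [IsLocalization.Away g T₂]

theorem eq_zero_of_algebraMap_eq_zero (hfg : IsCoprime f g) (t : T) (h₁ : algebraMap T T₁ t = 0)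
    (h₂ : algebraMap T T₂ t = 0) : t = 0 := by
  obtain ⟨k, hk⟩ := IsLocalization.Away.exists_of_eq (S := T₁) f (a := t) (b := 0) (by simpa)
  obtain ⟨l, hl⟩ := IsLocalization.Away.exists_of_eq (S := T₂) g (a := t) (b := 0) (by simpa)
  obtain ⟨a, b, hab⟩ := hfg.pow (m := k) (n := l)
  rw [mul_zero] at hk hl
  linear_combination a * hk + b * hl - t * hab

variable [IsLocalization.Away (algebraMap T T₁ g) T₃]

/-- `T` is the fibre product of `T[1/f]` and `T[1/g]` over `T[1/fg]`. -/
theorem exists_algebraMap_eq_of_eq (hfg : IsCoprime f g) (x : T₁) (y : T₂)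
    (hxy : algebraMap T₁ T₃ x = algebraMap T₂ T₃ y) :
    ∃ t : T, algebraMap T T₁ t = x ∧ algebraMap T T₂ t = y := by
  obtain ⟨k, s, hs⟩ := IsLocalization.Away.surj f x
  obtain ⟨l, t, ht⟩ := IsLocalization.Away.surj g y
  have h₃ : algebraMap T₁ T₃ (algebraMap T T₁ (s * g ^ l)) =
      algebraMap T₁ T₃ (algebraMap T T₁ (t * f ^ k)) := by
    rw [map_mul, map_mul, ← hs, map_mul, hxy, map_mul, map_mul,
      ← IsScalarTower.algebraMap_apply, ← IsScalarTower.algebraMap_apply,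
      IsScalarTower.algebraMap_apply T T₂ T₃ t, ← ht]
    simp only [map_mul, map_pow, ← IsScalarTower.algebraMap_apply]
    ring
  obtain ⟨j, hj⟩ := IsLocalization.Away.exists_of_eq (algebraMap T T₁ g) h₃
  rw [← map_pow, ← map_mul, ← map_mul] at hj
  obtain ⟨i, hi⟩ := IsLocalization.Away.exists_of_eq f hj
  obtain ⟨a, b, hab⟩ := hfg.pow (m := k + i) (n := l + j)
  have hf : IsUnit (algebraMap T T₁ f) := IsLocalization.Away.algebraMap_isUnit f
  have hg : IsUnit (algebraMap T T₂ g) := IsLocalization.Away.algebraMap_isUnit g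
  refine ⟨a * (f ^ i * s) + b * (g ^ j * t), ?_, ?_⟩
  · refine (hf.pow (k + i)).mul_right_cancel ?_
    have : (a * (f ^ i * s) + b * (g ^ j * t)) * f ^ (k + i) = s * f ^ i := by
      linear_combination f ^ i * s * hab - b * hi
    rw [← map_pow, ← map_mul, this, map_mul, ← hs, map_pow, map_pow]
    ring
  · refine (hg.pow (l + j)).mul_right_cancel ?_
    have : (a * (f ^ i * s) + b * (g ^ j * t)) * g ^ (l + j) = t * g ^ j := by
      linear_combination g ^ j * t * hab + a * hi
    rw [← map_pow, ← map_mul, this, map_mul, ← ht, map_pow, map_pow]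
    ring

end Gluing

/-! ### Matrix representations and their gluing -/

section Representations

variable (S E : Type*) [CommRing S] [Ring E] [Algebra S E]

/-- The `S`-algebra `E` has a homomorphism into a matrix algebra `Mₙ(T)` with `n ≥ 1`. -/
def HasMatrixRep (T : Type*) [CommRing T] [Algebra S T] : Prop :=
  ∃ (n : ℕ) (_ : NeZero n), Nonempty (E →ₐ[S] Matrix (Fin n) (Fin n) T)

variable {S E}

theorem HasMatrixRep.of_fintype {T : Type*} [CommRing T] [Algebra S T] {n : Type*} [Fintype n]
    [DecidableEq n] [Nonempty n] (ρ : E →ₐ[S] Matrix n n T) : HasMatrixRep S E T :=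
  ⟨Fintype.card n, ⟨Fintype.card_ne_zero⟩,
    ⟨((Matrix.reindexAlgEquiv S T (Fintype.equivFin n)) : Matrix n n T →ₐ[S] _).comp ρ⟩⟩

section Double

variable (S) {n : Type*} [Fintype n] [DecidableEq n] (m : Type*) [Fintype m] [DecidableEq m]
  {R : Type*} [CommRing R] [Algebra S R]

open scoped Kronecker in
/-- The homomorphism `X ↦ diag(X ⊗ 1, X ⊗ 1)`. -/
def doubleLeft : Matrix n n R →ₐ[S] Matrix (n × m ⊕ n × m) (n × m ⊕ n × m) R :=
  AlgHom.ofLinearMap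
    { toFun X := Matrix.fromBlocks (X ⊗ₖ 1) 0 0 (X ⊗ₖ 1)
      map_add' X Y := by simp [Matrix.add_kronecker, Matrix.fromBlocks_add]
      map_smul' s X := by simp [Matrix.smul_kronecker, Matrix.fromBlocks_smul] }
    (by simp)
    (fun X Y => by simp [Matrix.fromBlocks_multiply, ← Matrix.mul_kronecker_mul])

open scoped Kronecker in
/-- The homomorphism `X ↦ diag(1 ⊗ X, 1 ⊗ X)`. -/
def doubleRight : Matrix n n R →ₐ[S] Matrix (m × n ⊕ m × n) (m × n ⊕ m × n) R :=
  AlgHom.ofLinearMap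
    { toFun X := Matrix.fromBlocks (1 ⊗ₖ X) 0 0 (1 ⊗ₖ X)
      map_add' X Y := by simp [Matrix.kronecker_add, Matrix.fromBlocks_add]
      map_smul' s X := by simp [Matrix.kronecker_smul, Matrix.fromBlocks_smul] }
    (by simp)
    (fun X Y => by simp [Matrix.fromBlocks_multiply, ← Matrix.mul_kronecker_mul])

end Double

/-- The conjugate `a ↦ φ⁻¹ τ(a) φ` of a representation. -/
def conjRep {B : Type*} [Ring B] [Algebra S B] (τ : E →ₐ[S] B) (φ : Bˣ) : E →ₐ[S] B :=
  AlgHom.ofLinearMap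
    ((LinearMap.mulLeft S ((φ⁻¹ : Bˣ) : B)).comp
      ((LinearMap.mulRight S (φ : B)).comp τ.toLinearMap))
    (by simp)
    (fun a b => by simp [mul_assoc])

theorem conjRep_apply {B : Type*} [Ring B] [Algebra S B] (τ : E →ₐ[S] B) (φ : Bˣ) (a : E) :
    conjRep τ φ a = ((φ⁻¹ : Bˣ) : B) * (τ a * φ) := rfl

open scoped Kronecker in
/-- Matrix representations of an algebra `E` over `T[1/f]` and `T[1/g]` glue to one over `T`, if
`E ⊗ E` contains an involution `e` which conjugates `a ⊗ b` to `b ⊗ a`. The representations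
`ρ₁ ⊗ 1` and `1 ⊗ ρ₂` become conjugate over `T[1/fg]` by the involution `(ρ₁ ⊗ ρ₂)(e)`, and twice
this involution splits. -/
theorem HasMatrixRep.glue_of_isLocalization {T T₁ T₂ T₃ : Type*} [CommRing T] [CommRing T₁] [CommRing T₂]
    [CommRing T₃] [Algebra T T₁] [Algebra T T₂] [Algebra T T₃] [Algebra T₁ T₃] [Algebra T₂ T₃]
    [IsScalarTower T T₁ T₃] [IsScalarTower T T₂ T₃] [Algebra S T] [Algebra S T₁] [Algebra S T₂]
    [Algebra S T₃] [IsScalarTower S T T₁] [IsScalarTower S T T₂]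
    [IsScalarTower S T₁ T₃] [IsScalarTower S T₂ T₃] (f g : T) (hfg : IsCoprime f g)
    [IsLocalization.Away f T₁] [IsLocalization.Away g T₂]
    [IsLocalization.Away (algebraMap T T₁ g) T₃] [IsLocalization.Away (algebraMap T T₂ f) T₃]
    (e : E ⊗[S] E) (he : e * e = 1) (hcomm : ∀ a b, e * (a ⊗ₜ b) = (b ⊗ₜ a) * e)
    (h₁ : HasMatrixRep S E T₁) (h₂ : HasMatrixRep S E T₂) : HasMatrixRep S E T := by
  obtain ⟨n, _, ⟨ρ₁⟩⟩ := h₁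
  obtain ⟨m, _, ⟨ρ₂⟩⟩ := h₂
  let N := Fin n × Fin m ⊕ Fin n × Fin m
  let j₁ : T₁ →ₐ[S] T₃ := IsScalarTower.toAlgHom S T₁ T₃
  let j₂ : T₂ →ₐ[S] T₃ := IsScalarTower.toAlgHom S T₂ T₃
  let σ₁ : E →ₐ[S] Matrix (Fin n) (Fin n) T₃ := j₁.mapMatrix.comp ρ₁
  let σ₂ : E →ₐ[S] Matrix (Fin m) (Fin m) T₃ := j₂.mapMatrix.comp ρ₂
  let κ₁ : E →ₐ[S] Matrix (Fin n × Fin m) (Fin n × Fin m) T₃ := AlgHom.ofLinearMap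
    { toFun a := σ₁ a ⊗ₖ 1
      map_add' := by simp [Matrix.add_kronecker]
      map_smul' := by simp [Matrix.smul_kronecker] }
    (by simp) (fun a b => by simp [← Matrix.mul_kronecker_mul])
  let κ₂ : E →ₐ[S] Matrix (Fin n × Fin m) (Fin n × Fin m) T₃ := AlgHom.ofLinearMap
    { toFun a := 1 ⊗ₖ σ₂ a
      map_add' := by simp [Matrix.kronecker_add]
      map_smul' := by simp [Matrix.kronecker_smul] }
    (by simp) (fun a b => by simp [← Matrix.mul_kronecker_mul])
  let κ := Algebra.TensorProduct.lift κ₁ κ₂ fun a b => by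
    change (σ₁ a ⊗ₖ 1) * (1 ⊗ₖ σ₂ b) = (1 ⊗ₖ σ₂ b) * (σ₁ a ⊗ₖ 1)
    simp [← Matrix.mul_kronecker_mul]
  let u := κ e
  have hu : u * u = 1 := by rw [← map_mul, he, map_one]
  have hconj : ∀ a, u * κ₁ a = κ₂ a * u := fun a => by
    have h := congrArg κ (hcomm a 1)
    rw [map_mul, map_mul] at h
    simpa [κ] using h
  obtain ⟨φ, γ, hφγ⟩ := splits_fromBlocks_of_involution (T₁ := T₁) (T₂ := T₂) f g hfg u hu
  set ι₁ := (algebraMap T₁ T₃).mapMatrix (m := N)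
  set ι₂ := (algebraMap T₂ T₃).mapMatrix (m := N)
  let τ₁ : E →ₐ[S] Matrix N N T₁ := (doubleLeft S (Fin m)).comp ρ₁
  let τ₂ : E →ₐ[S] Matrix N N T₂ := (doubleRight S (Fin n)).comp ρ₂
  have hτ₁ : ∀ a, ι₁ (τ₁ a) = Matrix.fromBlocks (κ₁ a) 0 0 (κ₁ a) := fun a => by
    have : (ρ₁ a ⊗ₖ (1 : Matrix (Fin m) (Fin m) T₁)).map (algebraMap T₁ T₃) = κ₁ a := by
      change _ = (ρ₁ a).map (algebraMap T₁ T₃) ⊗ₖ 1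
      ext ⟨i, k⟩ ⟨j, l⟩
      by_cases h : k = l <;> simp [Matrix.kroneckerMap_apply, h]
    rw [← this]
    change (Matrix.fromBlocks (ρ₁ a ⊗ₖ 1) 0 0 (ρ₁ a ⊗ₖ 1)).map (algebraMap T₁ T₃) = _
    rw [Matrix.fromBlocks_map, Matrix.map_zero _ (map_zero _)]
  have hτ₂ : ∀ a, ι₂ (τ₂ a) = Matrix.fromBlocks (κ₂ a) 0 0 (κ₂ a) := fun a => by
    have : ((1 : Matrix (Fin n) (Fin n) T₂) ⊗ₖ ρ₂ a).map (algebraMap T₂ T₃) = κ₂ a := by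
      change _ = 1 ⊗ₖ (ρ₂ a).map (algebraMap T₂ T₃)
      ext ⟨i, k⟩ ⟨j, l⟩
      by_cases h : i = j <;> simp [Matrix.kroneckerMap_apply, h]
    rw [← this]
    change (Matrix.fromBlocks (1 ⊗ₖ ρ₂ a) 0 0 (1 ⊗ₖ ρ₂ a)).map (algebraMap T₂ T₃) = _
    rw [Matrix.fromBlocks_map, Matrix.map_zero _ (map_zero _)]
  have hglue : ∀ a, ι₁ (conjRep τ₁ φ a) = ι₂ (conjRep τ₂ γ⁻¹ a) := fun a => by
    have hU : (ι₁ φ * ι₂ γ) * ι₂ (τ₂ a) = ι₁ (τ₁ a) * (ι₁ φ * ι₂ γ) := by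
      rw [← hφγ, hτ₁, hτ₂, Matrix.fromBlocks_multiply, Matrix.fromBlocks_multiply]
      have : u * κ₂ a = κ₁ a * u := by
        calc u * κ₂ a = u * (κ₂ a * u) * u := by rw [mul_assoc, mul_assoc, hu, mul_one]
          _ = κ₁ a * u := by rw [← hconj, ← mul_assoc, hu, one_mul]
      simp [this]
    have hφ : ι₁ (φ⁻¹ : (Matrix N N T₁)ˣ).val * ι₁ φ = 1 := by
      rw [← map_mul, Units.inv_mul, map_one]
    have hγ : ι₂ γ * ι₂ (γ⁻¹ : (Matrix N N T₂)ˣ).val = 1 := by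
      rw [← map_mul, Units.mul_inv, map_one]
    rw [conjRep_apply, conjRep_apply, inv_inv, map_mul, map_mul, map_mul, map_mul]
    calc _ = ι₁ (φ⁻¹ : (Matrix N N T₁)ˣ).val * (ι₁ (τ₁ a) * (ι₁ φ * ι₂ γ)) *
          ι₂ (γ⁻¹ : (Matrix N N T₂)ˣ).val := by
            simp only [mul_assoc]
            rw [hγ, mul_one]
      _ = _ := by
            rw [← hU]
            simp only [← mul_assoc]
            rw [hφ, one_mul]
  -- `Mₙ(T)` is the fibre product of `Mₙ(T₁)` and `Mₙ(T₂)`, so the two conjugates define `E → Mₙ(T)`.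
  let j : Matrix N N T →ₐ[S] Matrix N N T₁ × Matrix N N T₂ :=
    (IsScalarTower.toAlgHom S T T₁).mapMatrix.prod (IsScalarTower.toAlgHom S T T₂).mapMatrix
  have hj : Function.Injective j := (injective_iff_map_eq_zero _).2 fun X hX => by
    ext i k
    exact eq_zero_of_algebraMap_eq_zero (T₁ := T₁) (T₂ := T₂) f g hfg _
      (congrFun (congrFun (congrArg Prod.fst hX) i) k)
      (congrFun (congrFun (congrArg Prod.snd hX) i) k)
  have hrange : ∀ a, ((conjRep τ₁ φ).prod (conjRep τ₂ γ⁻¹)) a ∈ j.range := fun a => by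
    have h := fun i k => exists_algebraMap_eq_of_eq (T₃ := T₃) f g hfg (conjRep τ₁ φ a i k)
      (conjRep τ₂ γ⁻¹ a i k) (congrFun (congrFun (hglue a) i) k)
    choose X hX using h
    exact ⟨Matrix.of X, Prod.ext (Matrix.ext fun i k => (hX i k).1)
      (Matrix.ext fun i k => (hX i k).2)⟩
  exact .of_fintype ((AlgEquiv.ofInjective j hj).symm.toAlgHom.comp
    (((conjRep τ₁ φ).prod (conjRep τ₂ γ⁻¹)).codRestrict j.range hrange))

theorem HasMatrixRep.glue {T : Type*} [CommRing T] [Algebra S T] (f g : T) (hfg : IsCoprime f g)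
    (e : E ⊗[S] E) (he : e * e = 1) (hcomm : ∀ a b, e * (a ⊗ₜ b) = (b ⊗ₜ a) * e)
    (h₁ : HasMatrixRep S E (Localization.Away f)) (h₂ : HasMatrixRep S E (Localization.Away g)) :
    HasMatrixRep S E T := by
  let T₁ := Localization.Away f
  let T₂ := Localization.Away g
  let T₃ := Localization.Away (algebraMap T T₁ g)
  let h : T₂ →ₐ[T] T₃ := IsLocalization.liftAlgHom (M := Submonoid.powers g)
    (f := Algebra.ofId T T₃) (by
      rintro ⟨_, k, rfl⟩
      change IsUnit (algebraMap T T₃ (g ^ k))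
      rw [map_pow, IsScalarTower.algebraMap_apply T T₁ T₃]
      exact (IsLocalization.Away.algebraMap_isUnit (algebraMap T T₁ g)).pow k)
  let _ : Algebra T₂ T₃ := h.toRingHom.toAlgebra
  have : IsScalarTower T T₂ T₃ := .of_algebraMap_eq fun x => (h.commutes x).symm
  have : IsScalarTower S T₂ T₃ := .of_algebraMap_eq fun x => by
    rw [IsScalarTower.algebraMap_apply S T T₃, IsScalarTower.algebraMap_apply S T T₂,
      IsScalarTower.algebraMap_apply T T₂ T₃]
  have : IsLocalization.Away (algebraMap T T₂ f) T₃ :=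
    IsLocalization.Away.commutes T₂ T₁ T₃ g f
  exact HasMatrixRep.glue_of_isLocalization (T₁ := T₁) (T₂ := T₂) (T₃ := T₃) f g hfg e he hcomm h₁ h₂

end Representations

/-! ### The exchange involution of an endomorphism algebra -/

section Exchange

variable {S P : Type*} [CommRing S] [AddCommGroup P] [Module S P] {n : Type*}
  (x : n → P) (f : n → P →ₗ[S] S)

/-- The endomorphism `y ↦ f j y • x i`. -/
def rankOne (i j : n) : Module.End S P := (f j).smulRight (x i)

/-- For a dual basis `(x, f)` of `P`, the element of `End P ⊗ End P` corresponding to the exchange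
`y ⊗ z ↦ z ⊗ y` of `P ⊗ P`. -/
def exchange [Fintype n] : Module.End S P ⊗[S] Module.End S P :=
  ∑ i, ∑ j, rankOne x f i j ⊗ₜ rankOne x f j i

theorem rankOne_mul_rankOne (i j k l : n) :
    rankOne x f i j * rankOne x f k l = f j (x k) • rankOne x f i l := by
  ext y
  simp only [rankOne, Module.End.mul_apply, LinearMap.smulRight_apply, LinearMap.smul_apply,
    map_smul, smul_smul]
  rw [mul_comm]

variable [Fintype n] (hxf : ∀ y, ∑ i, f i y • x i = y)

include hxf

theorem rankOne_mul (a : Module.End S P) (i j : n) :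
    rankOne x f i j * a = ∑ k, f j (a (x k)) • rankOne x f i k := by
  ext y
  simp only [rankOne, Module.End.mul_apply, LinearMap.smulRight_apply, LinearMap.smul_apply,
    LinearMap.sum_apply, smul_smul]
  conv_lhs => rw [← hxf y]
  simp only [map_sum, map_smul, smul_eq_mul, Finset.sum_smul]
  exact Finset.sum_congr rfl fun k _ => by rw [mul_comm]

theorem mul_rankOne (a : Module.End S P) (i j : n) :
    a * rankOne x f i j = ∑ k, f k (a (x i)) • rankOne x f k j := by
  ext y
  simp only [rankOne, Module.End.mul_apply, LinearMap.smulRight_apply, LinearMap.smul_apply,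
    LinearMap.sum_apply, map_smul]
  conv_lhs => rw [← hxf (a (x i))]
  rw [Finset.smul_sum]
  exact Finset.sum_congr rfl fun k _ => smul_comm _ _ _

theorem sum_rankOne : ∑ i, rankOne x f i i = 1 := by
  ext y
  simpa [rankOne] using hxf y

theorem exchange_mul_tmul (a b : Module.End S P) :
    exchange x f * (a ⊗ₜ b) = (b ⊗ₜ a) * exchange x f := by
  simp only [exchange, Finset.sum_mul, Finset.mul_sum, Algebra.TensorProduct.tmul_mul_tmul,
    rankOne_mul x f hxf, mul_rankOne x f hxf, TensorProduct.sum_tmul, TensorProduct.tmul_sum,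
    TensorProduct.smul_tmul_smul]
  -- Both sides are the sum of all `f j (a (x k)) f i (b (x l)) • (x i ⊗ f k) ⊗ (x j ⊗ f l)`.
  calc _ = ∑ i, ∑ j, ∑ l, ∑ k, (f j (a (x k)) * f i (b (x l))) •
        (rankOne x f i k ⊗ₜ[S] rankOne x f j l) := rfl
    _ = ∑ l, ∑ k, ∑ i, ∑ j, (f j (a (x k)) * f i (b (x l))) •
        (rankOne x f i k ⊗ₜ[S] rankOne x f j l) := by
      rw [Finset.sum_congr rfl fun i _ => Finset.sum_comm, Finset.sum_comm]
      refine Finset.sum_congr rfl fun l _ => ?_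
      rw [Finset.sum_congr rfl fun i _ => Finset.sum_comm, Finset.sum_comm]
    _ = _ := by
      refine Finset.sum_congr rfl fun l _ => Finset.sum_congr rfl fun k _ => ?_
      rw [Finset.sum_comm]
      refine Finset.sum_congr rfl fun i _ => Finset.sum_congr rfl fun j _ => ?_
      rw [mul_comm]

theorem exchange_mul_self : exchange x f * exchange x f = 1 := by
  have hr : ∀ l, ∑ i, f i (x l) • rankOne x f i l = rankOne x f l l := fun l => by
    simpa using (mul_rankOne x f hxf 1 l l).symm
  have h : ∀ i j, exchange x f * (rankOne x f i j ⊗ₜ rankOne x f j i) =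
      rankOne x f j j ⊗ₜ rankOne x f i i := fun k l => by
    calc _ = ∑ i, ∑ j, (f i (x l) • rankOne x f i l) ⊗ₜ[S] (f j (x k) • rankOne x f j k) := by
          simp only [exchange, Finset.sum_mul, Algebra.TensorProduct.tmul_mul_tmul,
            rankOne_mul_rankOne, TensorProduct.smul_tmul_smul, mul_comm]
      _ = _ := by simp only [← TensorProduct.tmul_sum, ← TensorProduct.sum_tmul, hr]
  calc exchange x f * exchange x f
      = ∑ i, ∑ j, exchange x f * (rankOne x f i j ⊗ₜ rankOne x f j i) := by
        simp only [← Finset.mul_sum]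
        rfl
    _ = 1 := by
        simp only [h, ← TensorProduct.tmul_sum, ← TensorProduct.sum_tmul, sum_rankOne x f hxf]
        rfl

end Exchange

/-! ### Azumaya algebras have matrix representations -/

section Embedding

variable {S : Type u} [CommRing S]

theorem HasMatrixRep.of_subsingleton {E T : Type*} [Ring E] [Algebra S E] [CommRing T]
    [Algebra S T] [Subsingleton T] : HasMatrixRep S E T :=
  ⟨1, inferInstance, ⟨AlgHom.ofLinearMap 0 (Subsingleton.elim _ _)
    fun _ _ => Subsingleton.elim _ _⟩⟩

/-- The ideal of all `s` such that `E` has matrix representations wherever `s` is invertible. It is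
closed under addition because matrix representations of `E` glue. -/
def repIdeal {E : Type*} [Ring E] [Algebra S E] (e : E ⊗[S] E) (he : e * e = 1)
    (hcomm : ∀ a b, e * (a ⊗ₜ b) = (b ⊗ₜ a) * e) : Ideal S where
  carrier := {s | ∀ (T : Type u) [CommRing T] [Algebra S T],
    IsUnit (algebraMap S T s) → HasMatrixRep S E T}
  zero_mem' T _ _ h := by
    rw [map_zero, isUnit_zero_iff] at h
    have := subsingleton_of_zero_eq_one h
    exact .of_subsingleton
  add_mem' := by
    rintro f g hf hg T _ _ h
    have hfg : IsCoprime (algebraMap S T f) (algebraMap S T g) := by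
      obtain ⟨v, hv⟩ := h.exists_left_inv
      exact ⟨v, v, by rw [← mul_add, ← map_add, hv]⟩
    refine HasMatrixRep.glue _ _ hfg e he hcomm (hf _ ?_) (hg _ ?_)
    · rw [IsScalarTower.algebraMap_apply S T (Localization.Away (algebraMap S T f))]
      exact IsLocalization.Away.algebraMap_isUnit _
    · rw [IsScalarTower.algebraMap_apply S T (Localization.Away (algebraMap S T g))]
      exact IsLocalization.Away.algebraMap_isUnit _
  smul_mem' c f hf T _ _ h := by
    rw [smul_eq_mul, map_mul] at h
    exact hf T (isUnit_of_mul_isUnit_right h)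

/-- A finite projective module is free wherever a suitable element outside `m` is invertible. -/
theorem exists_free_baseChange (P : Type u) [AddCommGroup P] [Module S P] [Module.Finite S P]
    [Module.Projective S P] (m : Ideal S) [m.IsMaximal] :
    ∃ r ∉ m, ∀ (T : Type u) [CommRing T] [Algebra S T], IsUnit (algebraMap S T r) →
      Module.Free T (T ⊗[S] P) := by
  have : Module.FinitePresentation S P := Module.finitePresentation_of_projective S P
  have : Module.Free (Localization.AtPrime m) (LocalizedModule m.primeCompl P) :=
    Module.free_of_flat_of_isLocalRing
  obtain ⟨r, hr, hfree, -⟩ := Module.FinitePresentation.exists_free_localizedModule_powers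
    m.primeCompl (LocalizedModule.mkLinearMap m.primeCompl P) (Localization.AtPrime m)
  refine ⟨r, hr, fun T _ _ hT => ?_⟩
  let h : Localization.Away r →ₐ[S] T := IsLocalization.liftAlgHom (M := Submonoid.powers r)
    (f := Algebra.ofId S T) (by
      rintro ⟨_, k, rfl⟩
      change IsUnit (algebraMap S T (r ^ k))
      rw [map_pow]
      exact hT.pow k)
  let _ : Algebra (Localization.Away r) T := h.toRingHom.toAlgebra
  have : IsScalarTower S (Localization.Away r) T := .of_algebraMap_eq fun x => (h.commutes x).symm
  have : Module.Free (Localization.Away r) (Localization.Away r ⊗[S] P) :=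
    .of_equiv (IsLocalizedModule.isBaseChange (Submonoid.powers r) (Localization.Away r)
      (LocalizedModule.mkLinearMap (Submonoid.powers r) P)).equiv.symm
  exact .of_equiv
    (TensorProduct.AlgebraTensorModule.cancelBaseChange S (Localization.Away r) T T P)

variable (S) in
/-- An Azumaya algebra `A` has a unital homomorphism into a matrix algebra. Since `A` acts on
itself, it suffices to represent the algebra `End A`. Where `A` is free this is a matrix algebra,
and these local representations glue. -/
theorem hasMatrixRep_of_isAzumaya (A : Type u) [Ring A] [Algebra S A] [IsAzumaya S A] :
    HasMatrixRep S A S := by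
  obtain ⟨n, x, f, -, hxf, -⟩ := azumaya_exists_data S A
  let I := repIdeal (exchange x f) (exchange_mul_self x f hxf) (exchange_mul_tmul x f hxf)
  have hI : I = ⊤ := by
    by_contra hI
    obtain ⟨m, hm, hIm⟩ := Ideal.exists_le_maximal I hI
    obtain ⟨r, hr, hfree⟩ := exists_free_baseChange A m
    refine hr (hIm fun T _ _ hT => ?_)
    rcases subsingleton_or_nontrivial T with hT' | hT'
    · exact .of_subsingleton
    have := hfree T hT
    have : Nontrivial (T ⊗[S] A) := ⟨1 ⊗ₜ 1, 0, fun h =>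
      one_ne_zero (azumaya_tmul_one_injective S A T 1 h)⟩
    have : Nonempty (Module.Free.ChooseBasisIndex T (T ⊗[S] A)) :=
      (Module.Free.chooseBasis T (T ⊗[S] A)).index_nonempty
    exact .of_fintype (((LinearMap.toMatrixAlgEquiv
      (Module.Free.chooseBasis T (T ⊗[S] A))).toAlgHom.restrictScalars S).comp
      (Module.End.baseChangeHom S T A))
  have h1 : (1 : S) ∈ I := hI ▸ trivial
  obtain ⟨k, hk, ⟨ρ⟩⟩ := h1 S (by simp)
  exact ⟨k, hk, ⟨ρ.comp (Algebra.lmul S A)⟩⟩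

end Embedding

/-! ### Tensor factors of Azumaya algebras, and centralizers -/

section Factor

open MulOpposite

theorem shuffle_bijective (R S A B : Type*) [CommRing R] [CommRing S] [Algebra R S] [Ring A]
    [Algebra R A] [Ring B] [Algebra S B] [Algebra R B] [IsScalarTower R S B] :
    Function.Bijective (shuffle R S A B) :=
  ((Algebra.TensorProduct.tensorTensorTensorComm R S R S B Bᵐᵒᵖ A Aᵐᵒᵖ).trans
    (Algebra.TensorProduct.congr (AlgEquiv.refl : (B ⊗[R] A) ≃ₐ[S] _)
      (Algebra.TensorProduct.opAlgEquiv R S B A))).bijective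

variable {S A C : Type*} [CommRing S] [Ring A] [Algebra S A] [Ring C] [Algebra S C]

/-- A tensor factor `A` of an Azumaya algebra `C ⊗ A` is Azumaya, if the other factor `C` has a
linear functional taking the value `1` at `1`. The functional makes `A` a retract of `C ⊗ A` and
`A ⊗ Aᵒᵖ` a retract of its enveloping algebra. -/
theorem isAzumaya_of_tensorProduct [IsAzumaya S (C ⊗[S] A)] (l : C →ₗ[S] S) (hl : l 1 = 1) :
    IsAzumaya S A := by
  let r : C ⊗[S] A →ₗ[S] A := (TensorProduct.lid S A).toLinearMap.comp (l.rTensor A)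
  have hr : ∀ c a, r (c ⊗ₜ a) = l c • a := fun c a => by simp [r]
  let i : A →ₗ[S] C ⊗[S] A := TensorProduct.mk S C A 1
  have hri : r.comp i = LinearMap.id := by
    ext a
    simp [hr, i, hl]
  have hproj : Module.Projective S A := .of_split i r hri
  have hfin : Module.Finite S A := .of_surjective r fun a => ⟨i a, DFunLike.congr_fun hri a⟩
  have hfaith : FaithfulSMul S A := by
    rw [faithfulSMul_iff_algebraMap_injective]
    refine (injective_iff_map_eq_zero _).2 fun s hs => ?_
    refine (injective_iff_map_eq_zero _).1 (FaithfulSMul.algebraMap_injective S (C ⊗[S] A)) s ?_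
    rw [Algebra.TensorProduct.algebraMap_apply', hs, TensorProduct.tmul_zero]
  let μ : C ⊗[S] Cᵐᵒᵖ →ₗ[S] S :=
    l.comp ((LinearMap.applyₗ (1 : C)).comp (AlgHom.mulLeftRight S C).toLinearMap)
  let q : (C ⊗[S] Cᵐᵒᵖ) ⊗[S] (A ⊗[S] Aᵐᵒᵖ) →ₗ[S] A ⊗[S] Aᵐᵒᵖ :=
    (TensorProduct.lid S _).toLinearMap.comp (μ.rTensor _)
  have hq : ∀ w a, AlgHom.mulLeftRight S A (q w) a =
      r (AlgHom.mulLeftRight S (C ⊗[S] A) (shuffle S S A C w) (1 ⊗ₜ a)) := fun w a => by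
    induction w using TensorProduct.induction_on with
    | zero => simp
    | add s t hs ht => simp only [map_add, LinearMap.add_apply, hs, ht]
    | tmul s t =>
      rw [mulLeftRight_shuffle, hr]
      simp [q, μ]
  have hb := IsAzumaya.bij (R := S) (A := C ⊗[S] A)
  refine ⟨(injective_iff_map_eq_zero _).2 fun t ht => ?_, fun g => ?_⟩
  · have h0 : (1 : C ⊗[S] Cᵐᵒᵖ) ⊗ₜ[S] t = 0 := by
      refine (injective_iff_map_eq_zero _).1 (shuffle_bijective S S A C).1 _
        ((injective_iff_map_eq_zero _).1 hb.1 _ ?_)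
      ext c a
      simp [mulLeftRight_shuffle, ht]
    have := congrArg q h0
    simpa [q, μ, hl] using this
  · obtain ⟨w', hw'⟩ := hb.2 (g.lTensor C)
    obtain ⟨w, rfl⟩ := (shuffle_bijective S S A C).2 w'
    refine ⟨q w, LinearMap.ext fun a => ?_⟩
    rw [hq, hw', LinearMap.lTensor_tmul, hr, hl, one_smul]

/-- A tensor factor of a matrix algebra is Azumaya: the other factor has the functional
`c ↦ (c ⊗ 1)₀₀`. -/
theorem isAzumaya_of_tensorProduct_equiv_matrix {n : ℕ} [NeZero n]
    (e : C ⊗[S] A ≃ₐ[S] Matrix (Fin n) (Fin n) S) : IsAzumaya S A := by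
  have := IsAzumaya.matrix S (Fin n)
  have : IsAzumaya S (C ⊗[S] A) := IsAzumaya.of_AlgEquiv S _ _ e.symm
  refine isAzumaya_of_tensorProduct (C := C)
    ((Matrix.entryLinearMap S S 0 0).comp
      (e.toLinearMap.comp ((TensorProduct.mk S C A).flip 1))) ?_
  change e (1 ⊗ₜ 1) 0 0 = 1
  rw [← Algebra.TensorProduct.one_def, map_one, Matrix.one_apply_eq]

/-- The product map `A ⊗ C → M`, `C` the centralizer of the image of `A` in `M`. -/
def centralizerMul {M : Type*} [Ring M] [Algebra S M] (ρ : A →ₐ[S] M) :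
    A ⊗[S] Subalgebra.centralizer S (Set.range ρ) →ₐ[S] M :=
  Algebra.TensorProduct.lift ρ (Subalgebra.centralizer S (Set.range ρ)).val
    fun a c => (Subalgebra.mem_centralizer_iff S).1 c.2 (ρ a) ⟨a, rfl⟩

/-- The double centralizer theorem: an algebra `M` containing an Azumaya algebra is the tensor
product with the centralizer. The elements `e i` of `A ⊗ Aᵒᵖ` dual to a dual basis `(x, f)` of `A`
project `M` to the centralizer, and `m = ∑ i, x i * (e i • m)`. -/
theorem centralizerMul_bijective {M : Type*} [Ring M] [Algebra S M] [IsAzumaya S A]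
    (ρ : A →ₐ[S] M) : Function.Bijective (centralizerMul ρ) := by
  obtain ⟨n, x, f, e, h₁, h₂, h₃⟩ := azumaya_exists_data S A
  let C := Subalgebra.centralizer S (Set.range ρ)
  let θ : A ⊗[S] Aᵐᵒᵖ →ₐ[S] Module.End S M :=
    (AlgHom.mulLeftRight S M).comp (Algebra.TensorProduct.map ρ ρ.op)
  have hθ : ∀ a b m, θ (a ⊗ₜ op b) m = ρ a * m * ρ b := fun a b m => by simp [θ]
  have hmem : ∀ i m, θ (e i) m ∈ C := fun i m => by
    refine (Subalgebra.mem_centralizer_iff S).2 ?_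
    rintro _ ⟨a, rfl⟩
    have : (a ⊗ₜ op 1) * e i = (1 ⊗ₜ op a) * e i := by
      refine IsAzumaya.bij.1 (LinearMap.ext fun y => ?_)
      rw [map_mul, map_mul, Module.End.mul_apply, Module.End.mul_apply, h₂]
      simp [Algebra.commutes]
    have h := congrArg (fun w => θ w m) this
    simpa only [map_mul, Module.End.mul_apply, hθ, map_one, one_mul, mul_one] using h
  have hcomm : ∀ w a (c : C), θ w (ρ a * c) = ρ (AlgHom.mulLeftRight S A w a) * c := fun w a c => by
    induction w using TensorProduct.induction_on with
    | zero => simp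
    | add s t hs ht => simp only [map_add, LinearMap.add_apply, hs, ht, add_mul]
    | tmul a₁ a₂ =>
      have hc := (Subalgebra.mem_centralizer_iff S).1 c.2 (ρ a₂.unop) ⟨_, rfl⟩
      rw [← op_unop a₂, hθ]
      simp only [AlgHom.mulLeftRight_apply, map_mul, mul_assoc, unop_op, hc]
  let θC : Fin n → M →ₗ[S] C := fun i => (θ (e i)).codRestrict C.toSubmodule (hmem i)
  let b : M →ₗ[S] A ⊗[S] C := ∑ i, (TensorProduct.mk S A C (x i)).comp (θC i)
  refine ⟨Function.LeftInverse.injective (g := b) fun t => ?_, fun m => ⟨b m, ?_⟩⟩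
  · induction t using TensorProduct.induction_on with
    | zero => simp
    | add s t hs ht => rw [map_add, map_add, hs, ht]
    | tmul a c =>
      have : ∀ i, θC i (ρ a * c) = f i a • c := fun i => by
        ext
        change θ (e i) (ρ a * c) = f i a • (c : M)
        rw [hcomm, h₂, AlgHom.commutes, Algebra.smul_def]
      change b (ρ a * c) = _
      simp only [b, LinearMap.sum_apply, LinearMap.comp_apply, TensorProduct.mk_apply, this]
      simp only [← TensorProduct.smul_tmul, ← TensorProduct.sum_tmul, h₁]
  · have h := congrArg (fun w => θ w m) (h₃ 1)
    simp only [map_sum, map_mul, LinearMap.sum_apply, Module.End.mul_apply, mul_one] at h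
    have h1 : ∀ i y, θ (x i ⊗ₜ[S] (1 : Aᵐᵒᵖ)) y = ρ (x i) * y := fun i y => by
      rw [← op_one, hθ, map_one, mul_one]
    simp only [h1, hθ, map_one, mul_one, one_mul] at h
    simp only [b, LinearMap.sum_apply, LinearMap.comp_apply, TensorProduct.mk_apply, map_sum]
    exact h

end Factor

/-! ### The Brauer monoid is a group -/

section Group

variable (S : Type u) [CommRing S]

/-- Azumaya algebras are invertible up to matrix algebras: the complementary factor is the
centralizer of the algebra in a matrix algebra. -/
theorem exists_tensorProduct_equiv_matrix (A : AzumayaAlg S) :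
    ∃ (C : AzumayaAlg S) (n : ℕ) (_ : NeZero n),
      Nonempty (A.carrier ⊗[S] C.carrier ≃ₐ[S] Matrix (Fin n) (Fin n) S) := by
  obtain ⟨n, hn, ⟨ρ⟩⟩ := hasMatrixRep_of_isAzumaya S A.carrier
  let e := AlgEquiv.ofBijective (centralizerMul ρ) (centralizerMul_bijective ρ)
  have := isAzumaya_of_tensorProduct_equiv_matrix e
  exact ⟨⟨Subalgebra.centralizer S (Set.range ρ)⟩, n, hn, ⟨e⟩⟩

theorem BM.isUnit (x : BM S) : IsUnit x := by
  obtain ⟨A, rfl⟩ : ∃ A : AzumayaAlg S, BM.mk A = x := by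
    obtain ⟨y, rfl⟩ := Con.mk'_surjective x
    obtain ⟨A, rfl⟩ := Quotient.exists_rep y
    exact ⟨A, rfl⟩
  obtain ⟨C, n, hn, ⟨e⟩⟩ := exists_tensorProduct_equiv_matrix S A
  refine IsUnit.of_mul_eq_one (BM.mk C) ?_
  refine (Con.eq (quotCon (MM S))).2 ⟨1, one_mem _, MA.mk (AzumayaAlg.matrix S n), ⟨n, hn, rfl⟩, ?_⟩
  rw [mul_one]
  refine Eq.trans ?_ (one_mul _).symm
  exact Quotient.sound ⟨e⟩

end Group

/-! ### Constants of an induced differential algebra -/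

section Constants

variable (R : Type u) [CommRing R] [Differential R]

theorem inducedDerivation_tmul {A₀ : Type*} [Ring A₀] [Algebra (constants R) A₀] (r : R) (a : A₀) :
    inducedDerivation R A₀ (r ⊗ₜ a) = Differential.deriv r ⊗ₜ a := rfl

theorem inducedDerivation_eq_zero_iff {A₀ : Type*} [Ring A₀] [Algebra (constants R) A₀]
    [Module.Flat (constants R) A₀] (x : R ⊗[constants R] A₀) :
    inducedDerivation R A₀ x = 0 ↔ ∃ a : A₀, 1 ⊗ₜ a = x := by
  have hex : Function.Exact (Algebra.linearMap (constants R) R) (derivLinear R) := fun r =>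
    ⟨fun h => ⟨⟨r, h⟩, rfl⟩, by rintro ⟨c, rfl⟩; exact c.2⟩
  constructor
  · intro hx
    obtain ⟨y, rfl⟩ := (Module.Flat.rTensor_exact A₀ hex x).1 hx
    obtain ⟨a, rfl⟩ := (TensorProduct.lid (constants R) A₀).symm.surjective y
    exact ⟨a, by simp⟩
  · rintro ⟨a, rfl⟩
    rw [inducedDerivation_tmul, Derivation.map_one_eq_zero, TensorProduct.zero_tmul]

theorem one_tmul_injective (A₀ : Type*) [Ring A₀] [Algebra (constants R) A₀]
    [Module.Flat (constants R) A₀] :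
    Function.Injective
      (Algebra.TensorProduct.includeRight : A₀ →ₐ[constants R] R ⊗[constants R] A₀) := by
  have h := Module.Flat.rTensor_preserves_injective_linearMap (M := A₀)
    (Algebra.linearMap (constants R) R) Subtype.val_injective
  intro a b hab
  refine (TensorProduct.lid (constants R) A₀).symm.injective (h ?_)
  simpa using hab

/-- A differential isomorphism between induced algebras restricts to their rings of constants,
which are the algebras they are induced from. -/
theorem nonempty_algEquiv_of_induced {A₀ B₀ : Type*} [Ring A₀] [Algebra (constants R) A₀]
    [Module.Flat (constants R) A₀] [Ring B₀] [Algebra (constants R) B₀]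
    [Module.Flat (constants R) B₀]
    (e : R ⊗[constants R] A₀ ≃ₐ[R] R ⊗[constants R] B₀)
    (he : ∀ x, e (inducedDerivation R A₀ x) = inducedDerivation R B₀ (e x)) :
    Nonempty (A₀ ≃ₐ[constants R] B₀) := by
  let jA : A₀ →ₐ[constants R] R ⊗[constants R] A₀ := Algebra.TensorProduct.includeRight
  let jB : B₀ →ₐ[constants R] R ⊗[constants R] B₀ := Algebra.TensorProduct.includeRight
  let i : A₀ →ₐ[constants R] R ⊗[constants R] B₀ :=
    (e.toAlgHom.restrictScalars (constants R)).comp jA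
  have hi : ∀ a, i a ∈ jB.range := fun a => by
    refine (inducedDerivation_eq_zero_iff R _).1 ?_
    change inducedDerivation R B₀ (e (1 ⊗ₜ a)) = 0
    rw [← he, (inducedDerivation_eq_zero_iff R _).2 ⟨a, rfl⟩, map_zero]
  let E := AlgEquiv.ofInjective jB (one_tmul_injective R B₀)
  let g : A₀ →ₐ[constants R] B₀ := E.symm.toAlgHom.comp (i.codRestrict jB.range hi)
  have hg : ∀ a, jB (g a) = e (jA a) := fun a =>
    congrArg Subtype.val (E.apply_symm_apply (i.codRestrict jB.range hi a))
  refine ⟨AlgEquiv.ofBijective g ⟨fun a b hab => one_tmul_injective R A₀ (e.injective ?_),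
    fun b => ?_⟩⟩
  · change e (jA a) = e (jA b)
    rw [← hg, ← hg, hab]
  · obtain ⟨a, ha⟩ := (inducedDerivation_eq_zero_iff R (e.symm (jB b))).1 (e.injective (by
      rw [he, AlgEquiv.apply_symm_apply, map_zero]
      exact (inducedDerivation_eq_zero_iff R _).2 ⟨b, rfl⟩))
    refine ⟨a, one_tmul_injective R B₀ ?_⟩
    change jB (g a) = jB b
    rw [hg]
    exact (congrArg e ha).trans (e.apply_symm_apply _)

end Constants

/-! ### Base change from the constants as a homomorphism of monoids -/

section BaseChange

variable (R : Type u) [CommRing R] [Differential R]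

/-- `R ⊗ (A₀ ⊗ B₀) ≃ (R ⊗ A₀) ⊗ (R ⊗ B₀)`. -/
noncomputable def distribEquiv (A₀ B₀ : Type*) [Ring A₀] [Algebra (constants R) A₀] [Ring B₀]
    [Algebra (constants R) B₀] : R ⊗[constants R] (A₀ ⊗[constants R] B₀) ≃ₐ[R]
      (R ⊗[constants R] A₀) ⊗[R] (R ⊗[constants R] B₀) :=
  (Algebra.TensorProduct.congr (Algebra.TensorProduct.lid R R).symm AlgEquiv.refl).trans
    (Algebra.TensorProduct.tensorTensorTensorComm (constants R) R (constants R) R R R A₀ B₀)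

theorem distribEquiv_symm_tmul {A₀ B₀ : Type*} [Ring A₀] [Algebra (constants R) A₀] [Ring B₀]
    [Algebra (constants R) B₀] (r s : R) (a : A₀) (b : B₀) :
    (distribEquiv R A₀ B₀).symm ((r ⊗ₜ a) ⊗ₜ (s ⊗ₜ b)) = (r * s) ⊗ₜ (a ⊗ₜ b) := rfl

theorem distribEquiv_symm_deriv (A₀ B₀ : Type*) [Ring A₀] [Algebra (constants R) A₀] [Ring B₀]
    [Algebra (constants R) B₀] (x : R ⊗[constants R] A₀) (y : R ⊗[constants R] B₀) :
    (distribEquiv R A₀ B₀).symm (inducedDerivation R A₀ x ⊗ₜ y) +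
      (distribEquiv R A₀ B₀).symm (x ⊗ₜ inducedDerivation R B₀ y) =
    inducedDerivation R (A₀ ⊗[constants R] B₀) ((distribEquiv R A₀ B₀).symm (x ⊗ₜ y)) := by
  induction x using TensorProduct.induction_on with
  | zero => simp
  | add s t hs ht =>
    simp only [map_add, TensorProduct.add_tmul] at hs ht ⊢
    rw [← hs, ← ht]; abel
  | tmul r a =>
    induction y using TensorProduct.induction_on with
    | zero => simp
    | add s t hs ht =>
      simp only [map_add, TensorProduct.tmul_add] at hs ht ⊢
      rw [← hs, ← ht]; abel
    | tmul s b =>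
      simp only [inducedDerivation_tmul, distribEquiv_symm_tmul]
      rw [← TensorProduct.add_tmul, Derivation.leibniz, smul_eq_mul, smul_eq_mul]
      congr 1
      ring

/-- `R ⊗ Mₙ(R^D) ≃ Mₙ(R)`. -/
noncomputable def matrixBaseChange (n : ℕ) :
    R ⊗[constants R] Matrix (Fin n) (Fin n) (constants R) ≃ₐ[R] Matrix (Fin n) (Fin n) R :=
  AlgEquiv.ofRingEquiv (f := (matrixEquivTensor (Fin n) (constants R) R).symm.toRingEquiv) fun r => by
    change (matrixEquivTensor (Fin n) (constants R) R).symm (r ⊗ₜ 1) = _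
    rw [matrixEquivTensor_apply_symm]
    simp [Algebra.algebraMap_eq_smul_one]

theorem matrixBaseChange_tmul (n : ℕ) (r : R) (X : Matrix (Fin n) (Fin n) (constants R)) :
    matrixBaseChange R n (r ⊗ₜ X) = r • X.map (algebraMap (constants R) R) :=
  matrixEquivTensor_apply_symm (Fin n) (constants R) R r X

theorem matrixBaseChange_deriv (n : ℕ)
    (x : R ⊗[constants R] Matrix (Fin n) (Fin n) (constants R)) :
    matrixBaseChange R n (inducedDerivation R _ x) =
      ExtDerivation.matrix R n (matrixBaseChange R n x) := by
  induction x using TensorProduct.induction_on with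
  | zero => simp
  | add s t hs ht => simp only [map_add, hs, ht]
  | tmul r X =>
    rw [inducedDerivation_tmul, matrixBaseChange_tmul, matrixBaseChange_tmul]
    ext i j
    change Differential.deriv r * (X i j : R) = Differential.deriv (r * (X i j : R))
    rw [Derivation.leibniz, show Differential.deriv (X i j : R) = 0 from (X i j).2]
    simp [mul_comm]

/-- `A₀ ↦ R ⊗ A₀` on isomorphism classes. -/
noncomputable def inducedHom : MA (constants R) →* MAdiff R where
  toFun := Quotient.map induced fun A B ⟨e⟩ => by
    have h : ∀ x : R ⊗[constants R] A.carrier,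
        Algebra.TensorProduct.congr (AlgEquiv.refl (R := R)) e (inducedDerivation R _ x) =
          inducedDerivation R _ (Algebra.TensorProduct.congr (AlgEquiv.refl (R := R)) e x) := by
      intro x
      induction x using TensorProduct.induction_on with
      | zero => simp
      | add s t hs ht => simp only [map_add, hs, ht]
      | tmul r a => rfl
    exact ⟨Algebra.TensorProduct.congr AlgEquiv.refl e, h⟩
  map_one' := by
    have h : ∀ x : R ⊗[constants R] constants R,
        Algebra.TensorProduct.rid (constants R) R R (inducedDerivation R _ x) =
          ExtDerivation.self R (Algebra.TensorProduct.rid (constants R) R R x) := by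
      intro x
      induction x using TensorProduct.induction_on with
      | zero => simp
      | add s t hs ht => simp only [map_add, hs, ht]
      | tmul r a => exact ((derivLinear R).map_smul a r).symm
    exact Quotient.sound ⟨Algebra.TensorProduct.rid (constants R) R R, h⟩
  map_mul' := by
    rintro ⟨A⟩ ⟨B⟩
    refine (Quotient.sound (tensor_iso (induced A) (induced B) (induced (A.tensor B))
      (distribEquiv R A.carrier B.carrier).symm ?_)).symm
    exact distribEquiv_symm_deriv R A.carrier B.carrier

theorem inducedHom_injective : Function.Injective (inducedHom R) := by
  rintro ⟨A⟩ ⟨B⟩ h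
  obtain ⟨e, he⟩ := Quotient.exact h
  exact Quotient.sound (nonempty_algEquiv_of_induced R e he)

theorem inducedHom_matrix (n : ℕ) [NeZero n] :
    inducedHom R (MA.mk (AzumayaAlg.matrix (constants R) n)) =
      MAdiff.mk (DiffAzumayaAlg.matrix R n) :=
  Quotient.sound ⟨matrixBaseChange R n, matrixBaseChange_deriv R n⟩

/-- The homomorphism `BM(R^D) → BM^diff(R)` induced by `A₀ ↦ R ⊗ A₀`. -/
noncomputable def brauerHom : BM (constants R) →* BMdiff R :=
  (quotCon (MM (constants R))).lift ((quotCon (MMdiff₀ R)).mk'.comp (inducedHom R)) (by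
    rintro x y ⟨_, ⟨m, hm, rfl⟩, _, ⟨n, hn, rfl⟩, h⟩
    refine (Con.eq (quotCon (MMdiff₀ R))).2 ⟨_, ⟨m, hm, rfl⟩, _, ⟨n, hn, rfl⟩, ?_⟩
    rw [← inducedHom_matrix, ← inducedHom_matrix, ← map_mul, h, map_mul])

theorem brauerHom_mk (A : AzumayaAlg (constants R)) :
    brauerHom R (BM.mk A) = BMdiff.mk (induced A) := rfl

theorem brauerHom_injective : Function.Injective (brauerHom R) := by
  intro x y h
  obtain ⟨x, rfl⟩ := Con.mk'_surjective x
  obtain ⟨y, rfl⟩ := Con.mk'_surjective y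
  obtain ⟨_, ⟨m, hm, rfl⟩, _, ⟨n, hn, rfl⟩, h⟩ := (Con.eq (quotCon (MMdiff₀ R))).1 h
  refine (Con.eq (quotCon (MM (constants R)))).2 ⟨_, ⟨m, hm, rfl⟩, _, ⟨n, hn, rfl⟩, ?_⟩
  refine inducedHom_injective R ?_
  rw [map_mul, map_mul, inducedHom_matrix, inducedHom_matrix]
  exact h

end BaseChange

/-! ### Differential tensor factors of matrix algebras are induced -/

section ConstantSubalgebra

variable {R : Type u} [CommRing R] [Differential R] {A : Type*} [Ring A] [Algebra R A]

/-- The `R^D`-algebra of constants of a differential `R`-algebra. -/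
def constantSubalgebra (d : ExtDerivation R A) : Subalgebra (constants R) A where
  carrier := {a | d a = 0}
  mul_mem' {a b} ha hb := by
    change d (a * b) = 0
    rw [d.leibniz, show d a = 0 from ha, show d b = 0 from hb, zero_mul, mul_zero, add_zero]
  add_mem' {a b} ha hb := by
    change d (a + b) = 0
    rw [map_add, show d a = 0 from ha, show d b = 0 from hb, add_zero]
  algebraMap_mem' c := by
    change d (algebraMap R A c) = 0
    rw [d.map_algebraMap, show Differential.deriv (c : R) = 0 from c.2, map_zero]

/-- The multiplication map `R ⊗ A^D → A`. -/
noncomputable def constantsMul (d : ExtDerivation R A) :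
    R ⊗[constants R] constantSubalgebra d →ₐ[R] A :=
  Algebra.TensorProduct.lift (Algebra.ofId R A) (constantSubalgebra d).val
    fun r _ => Algebra.commutes r _

theorem constantsMul_tmul (d : ExtDerivation R A) (r : R) (a : constantSubalgebra d) :
    constantsMul d (r ⊗ₜ a) = r • (a : A) := by
  rw [Algebra.smul_def]
  rfl

theorem constantsMul_deriv (d : ExtDerivation R A)
    (x : R ⊗[constants R] constantSubalgebra d) :
    constantsMul d (inducedDerivation R _ x) = d (constantsMul d x) := by
  induction x using TensorProduct.induction_on with
  | zero => simp
  | add s t hs ht => simp only [map_add, hs, ht]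
  | tmul r a =>
    rw [inducedDerivation_tmul, constantsMul_tmul, constantsMul_tmul, d.deriv_smul,
      show d (a : A) = 0 from a.2, smul_zero, add_zero]

end ConstantSubalgebra

section Retract

/-- A differential isomorphism `(R ⊗ A₀) ⊗ (R ⊗ B₀) ≃ Mₘ(R)` restricts to an isomorphism
`A₀ ⊗ B₀ ≃ Mₘ(R^D)` of the constants. -/
theorem nonempty_equiv_matrix_of_induced {R : Type u} [CommRing R] [Differential R]
    {A₀ B₀ : Type*} [Ring A₀] [Algebra (constants R) A₀] [Module.Flat (constants R) A₀]
    [Ring B₀] [Algebra (constants R) B₀] [Module.Flat (constants R) B₀] {m : ℕ}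
    (φ : (R ⊗[constants R] A₀) ⊗[R] (R ⊗[constants R] B₀) ≃ₐ[R] Matrix (Fin m) (Fin m) R)
    (hφ : ∀ x y, φ (inducedDerivation R A₀ x ⊗ₜ y) + φ (x ⊗ₜ inducedDerivation R B₀ y) =
      ExtDerivation.matrix R m (φ (x ⊗ₜ y))) :
    Nonempty (A₀ ⊗[constants R] B₀ ≃ₐ[constants R] Matrix (Fin m) (Fin m) (constants R)) := by
  let δ := distribEquiv R A₀ B₀
  let μ := matrixBaseChange R m
  refine nonempty_algEquiv_of_induced R ((δ.trans φ).trans μ.symm) fun z => ?_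
  obtain ⟨w, rfl⟩ := δ.symm.surjective z
  refine μ.injective ?_
  rw [matrixBaseChange_deriv]
  change μ (μ.symm (φ (δ _))) = ExtDerivation.matrix R m (μ (μ.symm (φ (δ _))))
  rw [AlgEquiv.apply_symm_apply, AlgEquiv.apply_symm_apply, AlgEquiv.apply_symm_apply]
  induction w using TensorProduct.induction_on with
  | zero => simp only [map_zero]
  | add s t hs ht => simp only [map_add, hs, ht]
  | tmul x y =>
    rw [← hφ, ← distribEquiv_symm_deriv, map_add]
    change φ (δ (δ.symm _) + δ (δ.symm _)) = _
    rw [AlgEquiv.apply_symm_apply, AlgEquiv.apply_symm_apply, map_add]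

variable {R : Type u} [CommRing R] [Differential R] {A B : Type*} [Ring A] [Algebra R A]
  [Ring B] [Algebra R B] {m : ℕ} [NeZero m]

/-- A differential tensor factor `A` of a differential matrix algebra `A ⊗ B ≃ Mₘ(R)` is a
horizontal retract of it: the functional `b ↦ (1 ⊗ b)₀₀` on `B` commutes with the derivations and
takes the value `1` at `1`. -/
theorem exists_horizontal_retraction (dA : ExtDerivation R A) (dB : ExtDerivation R B)
    (e : A ⊗[R] B ≃ₐ[R] Matrix (Fin m) (Fin m) R)
    (he : ∀ x, e (dA.tensor dB x) = ExtDerivation.matrix R m (e x)) :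
    ∃ π : Matrix (Fin m) (Fin m) R →ₗ[R] A,
      (∀ a, π (e (a ⊗ₜ 1)) = a) ∧ ∀ X, π (ExtDerivation.matrix R m X) = dA (π X) := by
  let l : B →ₗ[R] R :=
    (Matrix.entryLinearMap R R 0 0).comp (e.toLinearMap.comp (TensorProduct.mk R A B 1))
  have hl1 : l 1 = 1 := by
    change e (1 ⊗ₜ 1) 0 0 = 1
    rw [← Algebra.TensorProduct.one_def, map_one, Matrix.one_apply_eq]
  have hld : ∀ b, l (dB b) = Differential.deriv (l b) := fun b => by
    have h := he (1 ⊗ₜ b)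
    rw [ExtDerivation.tensor_tmul, ExtDerivation.map_one_eq_zero, TensorProduct.zero_tmul,
      zero_add] at h
    exact congrFun (congrFun h 0) 0
  let p : A ⊗[R] B →ₗ[R] A := (TensorProduct.rid R A).toLinearMap.comp (l.lTensor A)
  have hp : ∀ a b, p (a ⊗ₜ b) = l b • a := fun a b => by simp [p]
  refine ⟨p.comp e.symm.toLinearMap, fun a => ?_, fun X => ?_⟩
  · change p (e.symm (e (a ⊗ₜ 1))) = a
    rw [AlgEquiv.symm_apply_apply, hp, hl1, one_smul]
  · obtain ⟨x, rfl⟩ := e.surjective X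
    change p (e.symm _) = dA (p (e.symm (e x)))
    rw [← he, AlgEquiv.symm_apply_apply, AlgEquiv.symm_apply_apply]
    induction x using TensorProduct.induction_on with
    | zero => simp
    | add s t hs ht => simp only [map_add, hs, ht]
    | tmul a b =>
      rw [ExtDerivation.tensor_tmul, map_add, hp, hp, hp, hld, dA.deriv_smul, add_comm]

variable {dA : ExtDerivation R A} {dB : ExtDerivation R B}
  (e : A ⊗[R] B ≃ₐ[R] Matrix (Fin m) (Fin m) R)
  (he : ∀ x, e (dA.tensor dB x) = ExtDerivation.matrix R m (e x))

include he

/-- A differential tensor factor `A` of a differential matrix algebra is generated by its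
constants, which form a projective module. Under the retraction `π`, every `a : A` equals
`∑ i j, (a ⊗ 1) i j • π (E i j)`, and the elements `π (E i j)` are constant. -/
theorem projective_and_constantsMul_bijective :
    Module.Projective (constants R) (constantSubalgebra dA) ∧
      Function.Bijective (constantsMul dA) := by
  obtain ⟨π, hπ, hd⟩ := exists_horizontal_retraction dA dB e he
  have hE : ∀ i j, dA (π (Matrix.single i j 1)) = 0 := fun i j => by
    have : ExtDerivation.matrix R m (Matrix.single i j 1) = 0 := by
      ext k l
      change Differential.deriv (Matrix.single i j (1 : R) k l) = 0
      rw [Matrix.single_apply]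
      split_ifs <;> simp
    rw [← hd, this, map_zero]
  let ε : Fin m → Fin m → constantSubalgebra dA := fun i j => ⟨π (Matrix.single i j 1), hE i j⟩
  have hsum : ∀ X, π X = ∑ i, ∑ j, X i j • (ε i j : A) := fun X => by
    conv_lhs => rw [Matrix.matrix_eq_sum_single X]
    simp only [map_sum]
    refine Finset.sum_congr rfl fun i _ => Finset.sum_congr rfl fun j _ => ?_
    rw [← map_smul, Matrix.smul_single, smul_eq_mul, mul_one]
  have hconst : ∀ (a : constantSubalgebra dA) i j, e ((a : A) ⊗ₜ 1) i j ∈ constants R :=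
    fun a i j => by
      have h := he ((a : A) ⊗ₜ 1)
      rw [ExtDerivation.tensor_tmul, ExtDerivation.map_one_eq_zero, TensorProduct.tmul_zero,
        add_zero, show dA (a : A) = 0 from a.2, TensorProduct.zero_tmul, map_zero] at h
      exact (congrFun (congrFun h i) j).symm
  have hrepr : ∀ a : constantSubalgebra dA,
      ∑ i, ∑ j, (⟨e ((a : A) ⊗ₜ 1) i j, hconst a i j⟩ : constants R) • ε i j = a := fun a => by
    ext
    conv_rhs => rw [← hπ a, hsum]
    simp [Subring.smul_def]
  constructor
  · let s : constantSubalgebra dA →ₗ[constants R] Matrix (Fin m) (Fin m) (constants R) :=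
      { toFun a := Matrix.of fun i j => ⟨e ((a : A) ⊗ₜ 1) i j, hconst a i j⟩
        map_add' a b := by
          ext i j
          simp [TensorProduct.add_tmul]
        map_smul' c a := by
          ext i j
          simp [Subring.smul_def, ← TensorProduct.smul_tmul'] }
    let r : Matrix (Fin m) (Fin m) (constants R) →ₗ[constants R] constantSubalgebra dA :=
      { toFun X := ∑ i, ∑ j, X i j • ε i j
        map_add' X Y := by simp [add_smul, Finset.sum_add_distrib]
        map_smul' c X := by simp [Finset.smul_sum, mul_smul] }
    exact .of_split s r (LinearMap.ext hrepr)
  · let b : A → R ⊗[constants R] constantSubalgebra dA :=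
      fun a => ∑ i, ∑ j, e (a ⊗ₜ 1) i j ⊗ₜ ε i j
    refine ⟨Function.LeftInverse.injective (g := b) fun t => ?_, fun a => ⟨b a, ?_⟩⟩
    · induction t using TensorProduct.induction_on with
      | zero => simp [b]
      | add s t hs ht =>
        conv_rhs => rw [← hs, ← ht]
        simp [b, TensorProduct.add_tmul, Finset.sum_add_distrib]
      | tmul r a =>
        conv_rhs => rw [← hrepr a]
        simp only [TensorProduct.tmul_sum, ← TensorProduct.smul_tmul]
        refine Finset.sum_congr rfl fun i _ => Finset.sum_congr rfl fun j _ => ?_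
        congr 1
        rw [constantsMul_tmul, ← TensorProduct.smul_tmul', map_smul, Matrix.smul_apply,
          Subring.smul_def, smul_eq_mul, smul_eq_mul, mul_comm]
    · simp only [b, map_sum, constantsMul_tmul]
      rw [← hsum, hπ]

/-- The constants of a differential tensor factor of a differential matrix algebra `Mₘ(R)` are a
tensor factor of `Mₘ(R^D)`. -/
theorem nonempty_constants_equiv :
    Nonempty (constantSubalgebra dA ⊗[constants R] constantSubalgebra dB ≃ₐ[constants R]
      Matrix (Fin m) (Fin m) (constants R)) := by
  obtain ⟨hA, hA'⟩ := projective_and_constantsMul_bijective e he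
  obtain ⟨hB, hB'⟩ := projective_and_constantsMul_bijective (dA := dB) (dB := dA)
    ((Algebra.TensorProduct.comm R B A).trans e) (fun x => by
      induction x using TensorProduct.induction_on with
      | zero => simp
      | add s t hs ht => simp only [map_add, hs, ht]
      | tmul b a =>
        have h := he (a ⊗ₜ b)
        rw [ExtDerivation.tensor_tmul] at h
        rw [ExtDerivation.tensor_tmul, AlgEquiv.trans_apply, AlgEquiv.trans_apply, map_add]
        simp only [Algebra.TensorProduct.comm_tmul]
        rw [add_comm, h])
  refine nonempty_equiv_matrix_of_induced
    ((Algebra.TensorProduct.congr (AlgEquiv.ofBijective (constantsMul dA) hA')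
      (AlgEquiv.ofBijective (constantsMul dB) hB')).trans e) fun x y => ?_
  change e (constantsMul dA _ ⊗ₜ constantsMul dB _) +
    e (constantsMul dA _ ⊗ₜ constantsMul dB _) =
    ExtDerivation.matrix R m (e (constantsMul dA _ ⊗ₜ constantsMul dB _))
  rw [← he, ExtDerivation.tensor_tmul, constantsMul_deriv, constantsMul_deriv, map_add]

/-- A differential tensor factor of a differential matrix algebra is induced from an Azumaya
algebra over the constants. -/
theorem isAzumaya_constantSubalgebra : IsAzumaya (constants R) (constantSubalgebra dA) := by
  obtain ⟨ε⟩ := nonempty_constants_equiv e he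
  exact isAzumaya_of_tensorProduct_equiv_matrix
    ((Algebra.TensorProduct.comm (constants R) _ _).trans ε)

end Retract

section Units

variable (R : Type u) [CommRing R] [Differential R]

/-- Every unit of `BM^diff(R)` is the class of an induced algebra, namely of the one induced by the
constants of any representative. -/
theorem exists_brauerHom_eq_of_isUnit (x : BMdiff R) (hx : IsUnit x) :
    ∃ y, brauerHom R y = x := by
  obtain ⟨y, hxy⟩ := hx.exists_right_inv
  obtain ⟨x, rfl⟩ := Con.mk'_surjective x
  obtain ⟨y, rfl⟩ := Con.mk'_surjective y
  obtain ⟨_, ⟨n, hn, rfl⟩, _, ⟨m, hm, rfl⟩, h⟩ := (Con.eq (quotCon (MMdiff₀ R))).1 hxy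
  rw [one_mul, mul_assoc] at h
  obtain ⟨A, rfl⟩ := Quotient.exists_rep x
  obtain ⟨B, hB⟩ := Quotient.exists_rep (y * MAdiff.mk (DiffAzumayaAlg.matrix R n))
  rw [← hB] at h
  obtain ⟨e, he⟩ := Quotient.exact h
  have hA₀ := isAzumaya_constantSubalgebra (dA := A.D) (dB := B.D) e he
  have hb := (projective_and_constantsMul_bijective (dA := A.D) (dB := B.D) e he).2
  refine ⟨BM.mk ⟨constantSubalgebra A.D⟩, congrArg (quotCon (MMdiff₀ R)).mk' ?_⟩
  exact Quotient.sound ⟨AlgEquiv.ofBijective (constantsMul A.D) hb, constantsMul_deriv A.D⟩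

end Units

end DiffBrauer

theorem mainTheorem3 (R : Type u) [CommRing R] [Differential R] :
    (∀ x : DiffBrauer.BM (DiffBrauer.constants R), IsUnit x) ∧
    ∃ Φ : DiffBrauer.BM (DiffBrauer.constants R) ≃* (DiffBrauer.BMdiff R)ˣ,
      ∀ A₀ : DiffBrauer.AzumayaAlg (DiffBrauer.constants R),
        ((Φ (DiffBrauer.BM.mk A₀) : (DiffBrauer.BMdiff R)ˣ) : DiffBrauer.BMdiff R) =
          DiffBrauer.BMdiff.mk (DiffBrauer.induced A₀) := by
  have hu := DiffBrauer.BM.isUnit (DiffBrauer.constants R)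
  let F := (Units.map (DiffBrauer.brauerHom R)).comp
    (IsUnit.liftRight (MonoidHom.id (DiffBrauer.BM (DiffBrauer.constants R))) hu)
  have hF : ∀ x, (F x : DiffBrauer.BMdiff R) = DiffBrauer.brauerHom R x := fun _ => rfl
  refine ⟨hu, MulEquiv.ofBijective F ⟨fun x y h => ?_, fun v => ?_⟩, fun A₀ => ?_⟩
  · refine DiffBrauer.brauerHom_injective R ?_
    rw [← hF, ← hF, h]
  · obtain ⟨y, hy⟩ := DiffBrauer.exists_brauerHom_eq_of_isUnit R v v.isUnit
    exact ⟨y, Units.ext ((hF y).trans hy)⟩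
  · exact (hF _).trans (DiffBrauer.brauerHom_mk R A₀)
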